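/- Let $P>0$. Let $f:\mathbb R\to\mathbb R$ be a strictly convex $C^1$ function such that, for some constant $C_f>0$ and exponents $1\le p_1\le p_2<p_1+2$, $$|f'(s)|\le C_f(1+|s|)^{p_2}\quad(s\in\mathbb R),\qquad \inf_{a\in\mathbb R,\,s>0}\frac{f'(a+s)-f'(a)}{s^{p_1}}\ge C_f,$$ $$\sup_{|a|,|b|\le M,\ a\ne b}\frac{|f(a)-f(b)|}{|f'(a)-f'(b)|}<\infty\quad\text{for all } M>0 .$$ Let $K\in C^1(\mathbb R\setminus 2P\mathbb Z)$ be an odd $2P$-periodic function such that, for some constant $C_K>0$, $$|K(x)|\le \frac{C_K}{|x|},\qquad |K'(x)|\le\frac{C_K}{|x|^2}\qquad (x\in[-P,P]\setminus\{0\}).$$ Let $L^2_{\mathrm{per}}(\mathbb R)$ be the space of $2P$-periodic functions (modulo null sets) that are square integrable over $[-P,P]$, with the norm of $L^2([-P,P])$, and for $g\in L^2_{\mathrm{per}}(\mathbb R)$ put $$G_{\mathrm{per}}[g](x)=\lim_{\varepsilon\to0+}\int_{(-P,P)\setminus(-\varepsilon,\varepsilon)}K(y)\,g(x-y)\,dy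 .$$ An entropy weak solution of $$u_t+f(u)_x=G_{\mathrm{per}}[u],\qquad u(0,\cdot)=\bar u\in L^2_{\mathrm{per}}(\mathbb R),$$ is a function $u\in L^1_{\mathrm{loc}}([0,\infty)\times\mathbb R)$ such that (i) the map $t\mapsto u(t,\cdot)$ is continuous from $[0,\infty)$ to $L^2_{\mathrm{per}}(\mathbb R)$ and $u(0,\cdot)=\bar u$; and (ii) for every $k\in\mathbb R$ and every nonnegative $\phi\in C^1_c((0,\infty)\times\mathbb R)$, the following integral exists and satisfies $$\iint\Big[|u-k|\,\phi_t+\big(f(u)-f(k)\big)\,\mathrm{sign}(u-k)\,\phi_x+G_{\mathrm{per}}[u(t,\cdot)](x)\,\mathrm{sign}(u-k)\,\phi\Big]\,dx\,dt\ge0 .$$ **Theorem.** Let $u,v$ be entropy weak solutions with the same initial data $u(0,\cdot)=v(0,\cdot)=\bar u\in L^2_{\mathrm{per}}(\mathbb R)$. If, for some $T$, the total variations of $u(t,\cdot)$ and $v(t,\cdot)$ over $[-P,P]$ (the infimum of the total variation over all representatives modulo null sets) are bounded uniformly in $t\in[0,T]$, then $u$ and $v$ coincide on $[0,T]\times\mathbb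 R$: for every $t\in[0,T]$, $u(t,x)=v(t,x)$ for almost every $x\in\mathbb R$. -/

import Mathlib

open MeasureTheory Set Filter Topology
open scoped NNReal ENNReal

noncomputable section

namespace PerBalance

/-- Assumption **(F)** on the flux: `f` is `C¹`, strictly convex, `f'` grows at most like
`|s| ^ p₂`, increases at least like `s ^ p₁`, and the quotients `|f u - f v| / |f' u - f' v|` are
bounded on bounded sets (`f'` is strictly increasing, so that no denominator vanishes). -/
structure FluxCondition (f : ℝ → ℝ) : Prop where
  contDiff : ContDiff ℝ 1 f
  strictConvex : StrictConvexOn ℝ univ f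
  growth : ∃ Cf p₁ p₂ : ℝ, 0 < Cf ∧ 1 ≤ p₁ ∧ p₁ ≤ p₂ ∧ p₂ < p₁ + 2 ∧
    (∀ s : ℝ, |deriv f s| ≤ Cf * (1 + |s|) ^ p₂) ∧
    (∀ a s : ℝ, 0 < s → Cf ≤ (deriv f (a + s) - deriv f a) / s ^ p₁)
  quotient : ∀ M : ℝ, 0 < M → ∃ Λ : ℝ, ∀ u v : ℝ, |u| ≤ M → |v| ≤ M → u ≠ v →
    |f u - f v| / |deriv f u - deriv f v| ≤ Λ

/-- The set `ℝ ∖ 2Pℤ` on which the kernel is given. -/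
def offLattice (P : ℝ) : Set ℝ := {x | ∀ n : ℤ, x ≠ 2 * P * n}

/-- Assumption **(K)** on the kernel: `K ∈ C¹(ℝ ∖ 2Pℤ)` is odd, `2P`-periodic, and
`|K⁽ⁱ⁾(x)| ≤ C_K / |x| ^ (i + 1)` on `[-P, P] ∖ {0}` for `i = 0, 1`. The values of `K` on `2Pℤ`
are irrelevant. -/
structure KernelCondition (P : ℝ) (K : ℝ → ℝ) : Prop where
  contDiffOn : ContDiffOn ℝ 1 K (offLattice P)
  odd : ∀ x ∈ offLattice P, K (-x) = -K x
  periodic : ∀ x ∈ offLattice P, K (x + 2 * P) = K x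
  bound : ∃ CK : ℝ, 0 < CK ∧ ∀ x ∈ Icc (-P) P, x ≠ 0 →
    |K x| ≤ CK / |x| ∧ |deriv K x| ≤ CK / |x| ^ 2

/-- Membership in `L²_per(ℝ)`: `2P`-periodic (almost everywhere) and square integrable
over `[-P, P]`. -/
structure L2per (P : ℝ) (g : ℝ → ℝ) : Prop where
  periodic : ∀ᵐ x : ℝ, g (x + 2 * P) = g x
  memLp : MemLp g 2 (volume.restrict (Icc (-P) P))

/-- The periodic singular integral operator
`G_per[g](x) = lim_{ε → 0+} ∫_{(-P,P) ∖ (-ε,ε)} K(y) g(x - y) dy`. -/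
def Gper (P : ℝ) (K g : ℝ → ℝ) (x : ℝ) : ℝ :=
  limUnder (𝓝[>] (0 : ℝ)) fun ε : ℝ => ∫ y in Ioo (-P) P \ Ioo (-ε) ε, K y * g (x - y)

/-- The integrand of the entropy inequality with constant `k` and test function `φ`,
at the point `z = (t, x)`. -/
def entropyIntegrand (P : ℝ) (f K : ℝ → ℝ) (u : ℝ → ℝ → ℝ) (k : ℝ) (φ : ℝ × ℝ → ℝ)
    (z : ℝ × ℝ) : ℝ :=
  |u z.1 z.2 - k| * deriv (fun t => φ (t, z.2)) z.1
    + (f (u z.1 z.2) - f k) * Real.sign (u z.1 z.2 - k) * deriv (fun x => φ (z.1, x)) z.2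
    + Gper P K (u z.1) z.2 * Real.sign (u z.1 z.2 - k) * φ z

/-- Entropy weak solutions of `u_t + f(u)_x = G_per[u]`, `u(0, ·) = ubar`. Only the values `u t`
with `t ≥ 0` matter, and each `u t` matters only up to null sets. The entropy inequality includes
that its integral exists. -/
structure IsEntropyWeakSolution (P : ℝ) (f K ubar : ℝ → ℝ) (u : ℝ → ℝ → ℝ) : Prop where
  locallyIntegrable :
    LocallyIntegrableOn (fun z : ℝ × ℝ => u z.1 z.2) (Ici (0 : ℝ) ×ˢ (univ : Set ℝ)) volume
  mem_L2per : ∀ t : ℝ, 0 ≤ t → L2per P (u t)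
  continuous : ∀ t₀ : ℝ, 0 ≤ t₀ →
    Tendsto (fun t => eLpNorm (fun x => u t x - u t₀ x) 2 (volume.restrict (Icc (-P) P)))
      (𝓝[Ici 0] t₀) (𝓝 0)
  initial : u 0 =ᵐ[volume] ubar
  entropy : ∀ (k : ℝ) (φ : ℝ × ℝ → ℝ), ContDiff ℝ 1 φ → HasCompactSupport φ →
    tsupport φ ⊆ Ioi (0 : ℝ) ×ˢ (univ : Set ℝ) → (∀ z, 0 ≤ φ z) →
    IntegrableOn (entropyIntegrand P f K u k φ) (Ioi (0 : ℝ) ×ˢ (univ : Set ℝ)) volume ∧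
    0 ≤ ∫ z in Ioi (0 : ℝ) ×ˢ (univ : Set ℝ), entropyIntegrand P f K u k φ z

/-- The total variation over `[-P, P]` of a function that is given up to null sets: the infimum of
the variations of its representatives. -/
def totVar (P : ℝ) (g : ℝ → ℝ) : ℝ≥0∞ :=
  ⨅ (h : ℝ → ℝ) (_ : h =ᵐ[volume.restrict (Icc (-P) P)] g), eVariationOn h (Icc (-P) P)

end PerBalance

end

/-!
Two entropy solutions are compared in `L¹` over a period, with Kružkov's doubling of variables. The
source is a singular integral and is not bounded on `L¹`, but on functions of bounded variation it
loses only a logarithm, and Osgood's criterion tolerates that loss.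

**The singular integral.** A `2P`-periodic function `w` that equals almost everywhere on a period a
function of bounded variation has an `L¹` modulus of continuity that is linear
(`translationBound_of_eVariationOn_le`). As the kernel is odd and `O (1 / |y|)`, the principal value
is the integral of `K y * (w (x - y) - w (x + y))` over `0 < y ≤ P`, which converges absolutely for
almost every `x` (`KernelCondition.Gper_eq_symmIntegral`); no Calderón–Zygmund theory is needed.
Splitting at `y = δ` bounds its `L¹` norm over a period by a multiple of
`δ + ‖w‖₁ * log (P / δ)` (`lintegral_symmLIntegral_le`).

**The Kato inequality.** A uniform bound of the variation and `L²` continuity in time make the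
solutions bounded on `[0, T]`, so that the flux may be taken to be Lipschitz. Each solution is
replaced by a Borel measurable, bounded, exactly periodic representative `a`, `b`
(`exists_isPeriodicRep`), and the doubling of variables with test functions `Ψ z * ρ (w - z)` gives
`∂ₜ|a - b| + ∂ₓ (sign (a - b) (f a - f b)) ≤ |G[a] - G[b]|` in the sense of distributions
(`DoublingData.kato`). The discontinuity of the sign is harmless because only the absolute value of
the difference of the sources survives. Testing with `θ t * χ x`, where the translates of `χ` by the
periods form a partition of unity, removes the flux (`integral_time_inequality`).

**Osgood's argument.** With `m t = ‖u t - v t‖₁` and `δ = P e ^ (-l)` this becomes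
`m' ≤ 2 C l (m + κ)`, `κ = E e ^ (-l) / l`, for every `l > 0`. Grönwall's inequality gives
`m t ≤ E / l` for times `t ≤ 1 / (2 C)`, hence `m = 0` there as `l → ∞`, and the step can be
iterated (`eq_zero_of_antitoneOn_exp_mul`).
-/

namespace PerBalance

/-! ### Smooth steps and plateaus -/

/-- A smooth step: `0` up to `s`, `1` from `s + ε` on, monotone in between. -/
noncomputable def smoothStep (s ε r : ℝ) : ℝ := Real.smoothTransition ((r - s) / ε)

/-- A smooth plateau, rising on `[s, s + ε]` and falling on `[t, t + ε]`. -/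
noncomputable def plateau (s t ε r : ℝ) : ℝ := smoothStep s ε r - smoothStep t ε r

section Step

variable {s t ε : ℝ}

lemma contDiff_smoothStep : ContDiff ℝ 1 (smoothStep s ε) :=
  (Real.smoothTransition.contDiff (n := 1)).comp ((contDiff_id.sub contDiff_const).div_const ε)

lemma monotone_smoothStep (hε : 0 < ε) : Monotone (smoothStep s ε) := fun a b hab =>
  Real.smoothTransition.monotone (by gcongr)

lemma smoothStep_of_le (hε : 0 < ε) {r : ℝ} (hr : r ≤ s) : smoothStep s ε r = 0 :=
  Real.smoothTransition.zero_of_nonpos (div_nonpos_of_nonpos_of_nonneg (by linarith) hε.le)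

lemma smoothStep_of_ge (hε : 0 < ε) {r : ℝ} (hr : s + ε ≤ r) : smoothStep s ε r = 1 :=
  Real.smoothTransition.one_of_one_le ((one_le_div hε).2 (by linarith))

lemma smoothStep_sub (a : ℝ) (r : ℝ) : smoothStep (s + a) ε r = smoothStep s ε (r - a) := by
  simp only [smoothStep]
  congr 2
  ring

lemma hasDerivAt_smoothStep (r : ℝ) :
    HasDerivAt (smoothStep s ε) (deriv (smoothStep s ε) r) r :=
  ((contDiff_smoothStep.differentiable one_ne_zero) r).hasDerivAt

lemma continuous_deriv_smoothStep : Continuous (deriv (smoothStep s ε)) :=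
  contDiff_smoothStep.continuous_deriv le_rfl

lemma deriv_smoothStep_nonneg (hε : 0 < ε) (r : ℝ) : 0 ≤ deriv (smoothStep s ε) r :=
  (monotone_smoothStep hε).deriv_nonneg

lemma deriv_smoothStep_of_notMem (hε : 0 < ε) {r : ℝ} (hr : r ∉ Icc s (s + ε)) :
    deriv (smoothStep s ε) r = 0 := by
  rcases not_and_or.1 hr with h | h
  · have : smoothStep s ε =ᶠ[𝓝 r] fun _ => 0 := by
      filter_upwards [Iio_mem_nhds (not_le.1 h)] with x hx
      exact smoothStep_of_le hε (le_of_lt hx)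
    rw [this.deriv_eq, deriv_const]
  · have : smoothStep s ε =ᶠ[𝓝 r] fun _ => 1 := by
      filter_upwards [Ioi_mem_nhds (not_le.1 h)] with x hx
      exact smoothStep_of_ge hε (le_of_lt hx)
    rw [this.deriv_eq, deriv_const]

lemma integral_deriv_smoothStep_mul (hε : 0 < ε) (H : ℝ → ℝ) :
    ∫ r, deriv (smoothStep s ε) r * H r = ∫ r in s..s + ε, deriv (smoothStep s ε) r * H r := by
  rw [intervalIntegral.integral_of_le (by linarith), ← integral_Icc_eq_integral_Ioc,
    setIntegral_eq_integral_of_forall_compl_eq_zero]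
  intro x hx
  rw [deriv_smoothStep_of_notMem hε hx, zero_mul]

lemma integrable_deriv_smoothStep_mul (hε : 0 < ε) {H : ℝ → ℝ}
    (hH : ContinuousOn H (Icc s (s + ε))) :
    Integrable (fun r => deriv (smoothStep s ε) r * H r) := by
  have h : IntegrableOn (fun r => deriv (smoothStep s ε) r * H r) (Icc s (s + ε)) :=
    (continuous_deriv_smoothStep.continuousOn.mul hH).integrableOn_compact isCompact_Icc
  refine h.integrable_of_forall_notMem_eq_zero fun x hx => ?_
  rw [deriv_smoothStep_of_notMem hε hx, zero_mul]

/-- The derivative of a step is a probability density on `[s, s + ε]`. -/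
lemma integral_deriv_smoothStep_mul_le (hε : 0 < ε) {H : ℝ → ℝ} {c : ℝ}
    (hH : ContinuousOn H (Icc s (s + ε))) (hc : ∀ r ∈ Icc s (s + ε), H r ≤ c) :
    ∫ r, deriv (smoothStep s ε) r * H r ≤ c := by
  rw [integral_deriv_smoothStep_mul hε]
  have hone : ∫ r in s..s + ε, deriv (smoothStep s ε) r * c = c := by
    rw [intervalIntegral.integral_mul_const, intervalIntegral.integral_eq_sub_of_hasDerivAt
      (fun x _ => hasDerivAt_smoothStep x) (continuous_deriv_smoothStep.intervalIntegrable _ _),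
      smoothStep_of_ge hε le_rfl, smoothStep_of_le hε le_rfl]
    ring
  refine le_trans (intervalIntegral.integral_mono_on (by linarith) ?_ ?_ fun r hr => ?_) hone.le
  · refine ContinuousOn.intervalIntegrable ?_
    rw [uIcc_of_le (by linarith)]
    exact continuous_deriv_smoothStep.continuousOn.mul hH
  · exact (continuous_deriv_smoothStep.mul continuous_const).intervalIntegrable _ _
  · exact mul_le_mul_of_nonneg_left (hc r hr) (deriv_smoothStep_nonneg hε r)

lemma contDiff_plateau : ContDiff ℝ 1 (plateau s t ε) := contDiff_smoothStep.sub contDiff_smoothStep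

lemma deriv_plateau (r : ℝ) :
    deriv (plateau s t ε) r = deriv (smoothStep s ε) r - deriv (smoothStep t ε) r :=
  ((hasDerivAt_smoothStep r).sub (hasDerivAt_smoothStep r)).deriv

lemma plateau_nonneg (hε : 0 < ε) (hst : s ≤ t) (r : ℝ) : 0 ≤ plateau s t ε r := by
  have : smoothStep t ε r = smoothStep s ε (r - (t - s)) := by
    rw [← smoothStep_sub]; congr 1; ring
  rw [plateau, this, sub_nonneg]
  exact monotone_smoothStep hε (by linarith)

lemma plateau_of_notMem (hε : 0 < ε) (hst : s ≤ t) {r : ℝ} (hr : r ∉ Icc s (t + ε)) :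
    plateau s t ε r = 0 := by
  rcases not_and_or.1 hr with h | h
  · rw [plateau, smoothStep_of_le hε (not_le.1 h).le,
      smoothStep_of_le hε ((not_le.1 h).le.trans hst), sub_zero]
  · rw [plateau, smoothStep_of_ge hε (by linarith [not_le.1 h]),
      smoothStep_of_ge hε (not_le.1 h).le, sub_self]

lemma tsupport_plateau_subset (hε : 0 < ε) (hst : s ≤ t) :
    tsupport (plateau s t ε) ⊆ Icc s (t + ε) :=
  closure_minimal (fun r hr => by
    by_contra h
    exact hr (plateau_of_notMem hε hst h)) isClosed_Icc

lemma hasCompactSupport_plateau (hε : 0 < ε) (hst : s ≤ t) :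
    HasCompactSupport (plateau s t ε) :=
  HasCompactSupport.of_support_subset_isCompact isCompact_Icc
    (subset_closure.trans (tsupport_plateau_subset hε hst))

end Step

/-! ### Functions of time that are nonincreasing in the sense of distributions -/

/-- A continuous function whose distributional derivative is nonpositive is nonincreasing. -/
lemma antitoneOn_of_integral_deriv_mul_nonneg {T : ℝ} {H : ℝ → ℝ} (hH : ContinuousOn H (Icc 0 T))
    (h : ∀ θ : ℝ → ℝ, ContDiff ℝ 1 θ → HasCompactSupport θ → tsupport θ ⊆ Ioo 0 T → (∀ r, 0 ≤ θ r) →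
      0 ≤ ∫ r, deriv θ r * H r) : AntitoneOn H (Icc 0 T) := by
  have key : ∀ s t, 0 < s → s < t → t < T → H t ≤ H s := by
    intro s t hs hst ht
    by_contra! hlt
    -- A plateau that rises right after `s`, where `H < c`, and falls right after `t`, where
    -- `d < H`, has `∫ θ' H ≤ c - d < 0`.
    obtain ⟨c, hc1, hc2⟩ := exists_between hlt
    obtain ⟨d, hd1, hd2⟩ := exists_between hc2
    have hHs : ContinuousAt H s := hH.continuousAt (Icc_mem_nhds hs (hst.trans ht))
    have hHt : ContinuousAt H t := hH.continuousAt (Icc_mem_nhds (hs.trans hst) ht)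
    obtain ⟨e1, he1, h1⟩ := Metric.eventually_nhds_iff.1 (hHs.eventually (gt_mem_nhds hc1))
    obtain ⟨e2, he2, h2⟩ := Metric.eventually_nhds_iff.1 (hHt.eventually (lt_mem_nhds hd2))
    obtain ⟨ε, hε, hεl⟩ : ∃ ε > 0, ε < min (min e1 e2) (T - t) :=
      exists_between (lt_min (lt_min he1 he2) (by linarith))
    obtain ⟨hεl, hε3⟩ := lt_min_iff.1 hεl
    obtain ⟨hε1, hε2⟩ := lt_min_iff.1 hεl
    have hcs : ContinuousOn H (Icc s (s + ε)) :=
      hH.mono (Icc_subset_Icc hs.le (by linarith))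
    have hct : ContinuousOn H (Icc t (t + ε)) :=
      hH.mono (Icc_subset_Icc (hs.trans hst).le (by linarith))
    have A : ∫ r, deriv (smoothStep s ε) r * H r ≤ c :=
      integral_deriv_smoothStep_mul_le hε hcs fun r hr => (h1 (by
        rw [Real.dist_eq, abs_lt]; constructor <;> linarith [hr.1, hr.2])).le
    have B : ∫ r, deriv (smoothStep t ε) r * (-H r) ≤ -d :=
      integral_deriv_smoothStep_mul_le hε hct.neg fun r hr => neg_le_neg (h2 (by
        rw [Real.dist_eq, abs_lt]; constructor <;> linarith [hr.1, hr.2])).le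
    have C := h (plateau s t ε) contDiff_plateau (hasCompactSupport_plateau hε hst.le)
      ((tsupport_plateau_subset hε hst.le).trans fun r hr =>
        ⟨by linarith [hr.1], by linarith [hr.2]⟩)
      (plateau_nonneg hε hst.le)
    simp only [deriv_plateau, sub_mul] at C
    rw [integral_sub (integrable_deriv_smoothStep_mul hε hcs)
      (integrable_deriv_smoothStep_mul hε hct)] at C
    simp only [mul_neg, integral_neg] at B
    linarith
  intro s hs t ht hst
  rcases hst.eq_or_lt with rfl | hlt
  · exact le_rfl
  have hlim : ∀ x ∈ Icc 0 T, ∀ g : ℝ → ℝ, Continuous g → g 0 = x →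
      (∀ᶠ e in 𝓝[>] (0 : ℝ), g e ∈ Icc 0 T) →
      Tendsto (fun e => H (g e)) (𝓝[>] (0 : ℝ)) (𝓝 (H x)) := by
    intro x hx g hg hg0 hgT
    refine (hH x hx).tendsto.comp (tendsto_nhdsWithin_iff.2 ⟨?_, hgT⟩)
    exact hg0 ▸ (hg.tendsto 0).mono_left nhdsWithin_le_nhds
  have hsmall : ∀ᶠ e in 𝓝[>] (0 : ℝ), 0 < e ∧ e < (t - s) / 2 := by
    filter_upwards [Ioo_mem_nhdsGT (show (0 : ℝ) < (t - s) / 2 by linarith)] with e he using he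
  refine le_of_tendsto_of_tendsto
    (hlim t ht (fun e => t - e) (by fun_prop) (by simp) ?_)
    (hlim s hs (fun e => s + e) (by fun_prop) (by simp) ?_) ?_
  · filter_upwards [hsmall] with e he
    constructor <;> linarith [he.1, he.2, hs.1, ht.2]
  · filter_upwards [hsmall] with e he
    constructor <;> linarith [he.1, he.2, hs.1, ht.2]
  · filter_upwards [hsmall] with e he
    exact key _ _ (by linarith [he.1, hs.1]) (by linarith [he.2]) (by linarith [he.1, ht.2])

lemma integrable_mul_of_tsupport_subset_Ioo {T : ℝ} {g m : ℝ → ℝ} (hg : Continuous g)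
    (hgT : tsupport g ⊆ Ioo 0 T) (hm : ContinuousOn m (Icc 0 T)) :
    Integrable fun r => g r * m r := by
  have h1 : IntegrableOn (fun r => g r * m r) (Icc 0 T) :=
    (hg.continuousOn.mul hm).integrableOn_compact isCompact_Icc
  refine h1.integrable_of_forall_notMem_eq_zero fun x hx => ?_
  rw [image_eq_zero_of_notMem_tsupport fun h' => hx (Ioo_subset_Icc_self (hgT h')), zero_mul]

/-- A differential form of Grönwall's inequality for continuous functions satisfying
`m' ≤ L (m + κ)` in the sense of distributions. -/
lemma antitoneOn_exp_mul_of_distributional_le {T L κ : ℝ} {m : ℝ → ℝ}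
    (hm : ContinuousOn m (Icc 0 T))
    (h : ∀ θ : ℝ → ℝ, ContDiff ℝ 1 θ → HasCompactSupport θ → tsupport θ ⊆ Ioo 0 T → (∀ r, 0 ≤ θ r) →
      0 ≤ ∫ r, (deriv θ r * m r + θ r * (L * (m r + κ)))) :
    AntitoneOn (fun t => Real.exp (-(L * t)) * (m t + κ)) (Icc 0 T) := by
  have hexp : ContDiff ℝ 1 fun r : ℝ => Real.exp (-(L * r)) := by fun_prop
  refine antitoneOn_of_integral_deriv_mul_nonneg
    (hexp.continuous.continuousOn.mul (hm.add continuousOn_const)) fun η hη hηc hηT hη0 => ?_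
  -- The integrating factor goes into the test function; the term `κ θ'` that this produces has
  -- integral zero.
  set θ : ℝ → ℝ := fun r => Real.exp (-(L * r)) * η r with hθ
  have hθd : ContDiff ℝ 1 θ := hexp.mul hη
  have hθc : HasCompactSupport θ := hηc.mul_left
  have hder : ∀ r, deriv θ r = Real.exp (-(L * r)) * (deriv η r - L * η r) := by
    intro r
    have h1 : HasDerivAt (fun r : ℝ => Real.exp (-(L * r))) (Real.exp (-(L * r)) * (-(L * 1))) r :=
      ((hasDerivAt_id r).const_mul L).neg.exp
    have h2 := h1.mul ((hη.differentiable one_ne_zero) r).hasDerivAt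
    rw [show deriv θ r = _ from h2.deriv]
    ring
  have hsupp : tsupport θ ⊆ tsupport η := closure_mono fun r hr => by
    intro h0; exact hr (by simp [hθ, h0])
  have key := h θ hθd hθc (hsupp.trans hηT) fun r => mul_nonneg (Real.exp_pos _).le (hη0 r)
  have hdi : Integrable (deriv θ) volume :=
    (hθd.continuous_deriv le_rfl).integrable_of_hasCompactSupport hθc.deriv
  have hd0 : ∫ r, deriv θ r = 0 :=
    integral_eq_zero_of_hasDerivAt_of_integrable
      (fun x => ((hθd.differentiable one_ne_zero) x).hasDerivAt) hdi
      (hθd.continuous.integrable_of_hasCompactSupport hθc)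
  have hi : Integrable fun r => deriv θ r * m r + θ r * (L * (m r + κ)) := by
    have e1 := integrable_mul_of_tsupport_subset_Ioo (hθd.continuous_deriv le_rfl)
      (tsupport_deriv_subset.trans (hsupp.trans hηT)) hm
    have e2 := (integrable_mul_of_tsupport_subset_Ioo hθd.continuous (hsupp.trans hηT)
      hm).const_mul L
    have e3 := ((hθd.continuous.integrable_of_hasCompactSupport hθc :
      Integrable θ volume)).const_mul (L * κ)
    refine (e1.add (e2.add e3)).congr (ae_of_all _ fun r => ?_)
    simp only [Pi.add_apply]
    ring
  have : ∫ r, deriv η r * (Real.exp (-(L * r)) * (m r + κ)) =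
      ∫ r, (deriv θ r * m r + θ r * (L * (m r + κ)) + κ * deriv θ r) := by
    congr 1
    ext r
    rw [hder, hθ]
    ring
  rw [this, integral_add hi (hdi.const_mul κ), integral_const_mul, hd0, mul_zero, add_zero]
  exact key

/-! ### Translations are continuous in `L¹` -/

section Translation

lemma tendsto_integral_norm_translate_sub {g : ℝ × ℝ → ℝ} (hg : Integrable g) :
    Tendsto (fun h => ∫ z, ‖g (h + z) - g z‖) (𝓝 0) (𝓝 0) := by
  have hm : MemLp g 1 volume := memLp_one_iff_integrable.2 hg
  have : Fact ((1 : ℝ≥0∞) ≠ ∞) := ⟨ENNReal.one_ne_top⟩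
  have hc : Continuous fun h : ℝ × ℝ => DomAddAct.mk h +ᵥ hm.toLp g :=
    (continuous_id.vadd continuous_const).comp DomAddAct.continuous_mk
  have h0 : Tendsto (fun h : ℝ × ℝ => ‖(DomAddAct.mk h +ᵥ hm.toLp g) - hm.toLp g‖) (𝓝 0) (𝓝 0) := by
    have := (hc.sub (continuous_const (y := hm.toLp g))).norm.tendsto 0
    simpa using this
  refine h0.congr fun h => ?_
  have hm' : MemLp (fun z => g (h + z)) 1 volume :=
    memLp_one_iff_integrable.2 (hg.comp_add_left h)
  have : DomAddAct.mk h +ᵥ hm.toLp g = hm'.toLp _ := DomAddAct.mk_vadd_toLp h hm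
  rw [this, ← MemLp.toLp_sub, L1.norm_eq_integral_norm]
  refine integral_congr_ae ?_
  filter_upwards [MemLp.coeFn_toLp (hm'.sub hm)] with z hz
  rw [hz]
  rfl

lemma LocallyIntegrable.comp_add_const {g : ℝ × ℝ → ℝ} (hg : LocallyIntegrable g) (h : ℝ × ℝ) :
    LocallyIntegrable fun z => g (z + h) := by
  have := (locallyIntegrable_map_homeomorph (Homeomorph.addRight h) (f := g) (μ := volume))
  rw [Homeomorph.coe_addRight, map_add_right_eq_self] at this
  exact this.1 hg

lemma tendsto_integral_mul_norm_translate_sub {g Ψ : ℝ × ℝ → ℝ} (hg : LocallyIntegrable g)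
    (hΨ : Continuous Ψ) (hc : HasCompactSupport Ψ) :
    Tendsto (fun h => ∫ z, |g (z + h) - g z| * |Ψ z|) (𝓝 0) (𝓝 0) := by
  -- For `‖h‖ ≤ 1` only the values of `g` on a compact neighbourhood of the support matter.
  set S := Metric.cthickening 1 (tsupport Ψ) with hS
  have hSc : IsCompact S := hc.isCompact.cthickening
  set g1 := S.indicator g with hg1
  have hg1i : Integrable g1 := (hg.integrableOn_isCompact hSc).integrable_indicator
    hSc.isClosed.measurableSet
  obtain ⟨C, hC⟩ := hΨ.bounded_above_of_compact_support hc
  have hlim := (tendsto_integral_norm_translate_sub hg1i).mul_const C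
  rw [zero_mul] at hlim
  refine squeeze_zero'
    (Eventually.of_forall fun h => integral_nonneg fun z => by positivity) ?_ hlim
  filter_upwards [Metric.closedBall_mem_nhds (0 : ℝ × ℝ) one_pos] with h hh
  rw [← integral_mul_const]
  have hi : Integrable (fun z => ‖g1 (h + z) - g1 z‖ * C) :=
    ((hg1i.comp_add_left h).sub hg1i).norm.mul_const C
  refine integral_mono_of_nonneg (ae_of_all _ fun z => by positivity) hi (ae_of_all _ fun z => ?_)
  have hC0 : 0 ≤ C := (norm_nonneg _).trans (hC 0)
  by_cases hz : z ∈ tsupport Ψ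
  · have h1 : z ∈ S := Metric.self_subset_cthickening _ hz
    have h2 : h + z ∈ S := by
      refine Metric.mem_cthickening_of_dist_le (h + z) z 1 _ hz ?_
      simpa [dist_eq_norm] using hh
    simp only [hg1, indicator_of_mem h1, indicator_of_mem h2]
    rw [add_comm z h]
    exact mul_le_mul_of_nonneg_left (hC z) (abs_nonneg _)
  · simp only [image_eq_zero_of_notMem_tsupport hz, abs_zero, mul_zero]
    positivity

lemma LocallyIntegrable.integrable_mul_compactSupport {g Ψ : ℝ × ℝ → ℝ} (hg : LocallyIntegrable g)
    (hΨ : Continuous Ψ) (hc : HasCompactSupport Ψ) : Integrable fun z => g z * Ψ z := by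
  simpa [mul_comm] using hg.integrable_smul_left_of_hasCompactSupport hΨ hc

lemma locallyIntegrable_of_bound {a : ℝ × ℝ → ℝ} {M : ℝ} (ha : Measurable a)
    (hM : ∀ z, |a z| ≤ M) : LocallyIntegrable a :=
  (locallyIntegrable_const M).mono ha.aestronglyMeasurable
    (ae_of_all _ fun z => (hM z).trans (le_abs_self M))

end Translation

/-! ### Partial derivatives -/

section Partial

/-- The partial derivative in time of a function of `(t, x)`. -/
noncomputable def partialT (φ : ℝ × ℝ → ℝ) (z : ℝ × ℝ) : ℝ := deriv (fun t => φ (t, z.2)) z.1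

/-- The partial derivative in space of a function of `(t, x)`. -/
noncomputable def partialX (φ : ℝ × ℝ → ℝ) (z : ℝ × ℝ) : ℝ := deriv (fun x => φ (z.1, x)) z.2

variable {φ ψ : ℝ × ℝ → ℝ}

lemma hasDerivAt_partialT (hφ : ContDiff ℝ 1 φ) (z : ℝ × ℝ) :
    HasDerivAt (fun t => φ (t, z.2)) (fderiv ℝ φ z (1, 0)) z.1 := by
  have h1 : HasFDerivAt φ (fderiv ℝ φ z) (z.1, z.2) :=
    ((hφ.differentiable one_ne_zero) z).hasFDerivAt
  exact h1.comp_hasDerivAt z.1 ((hasDerivAt_id z.1).prodMk (hasDerivAt_const z.1 z.2))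

lemma hasDerivAt_partialX (hφ : ContDiff ℝ 1 φ) (z : ℝ × ℝ) :
    HasDerivAt (fun x => φ (z.1, x)) (fderiv ℝ φ z (0, 1)) z.2 := by
  have h1 : HasFDerivAt φ (fderiv ℝ φ z) (z.1, z.2) :=
    ((hφ.differentiable one_ne_zero) z).hasFDerivAt
  exact h1.comp_hasDerivAt z.2 ((hasDerivAt_const z.2 z.1).prodMk (hasDerivAt_id z.2))

lemma partialT_eq (hφ : ContDiff ℝ 1 φ) : partialT φ = fun z => fderiv ℝ φ z (1, 0) :=
  funext fun z => (hasDerivAt_partialT hφ z).deriv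

lemma partialX_eq (hφ : ContDiff ℝ 1 φ) : partialX φ = fun z => fderiv ℝ φ z (0, 1) :=
  funext fun z => (hasDerivAt_partialX hφ z).deriv

lemma continuous_partialT (hφ : ContDiff ℝ 1 φ) : Continuous (partialT φ) := by
  rw [partialT_eq hφ]
  exact (hφ.continuous_fderiv one_ne_zero).clm_apply continuous_const

lemma continuous_partialX (hφ : ContDiff ℝ 1 φ) : Continuous (partialX φ) := by
  rw [partialX_eq hφ]
  exact (hφ.continuous_fderiv one_ne_zero).clm_apply continuous_const

lemma partialT_of_notMem_tsupport (hφ : ContDiff ℝ 1 φ) {z : ℝ × ℝ} (hz : z ∉ tsupport φ) :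
    partialT φ z = 0 := by
  rw [partialT_eq hφ]
  simp [fderiv_of_notMem_tsupport (𝕜 := ℝ) hz]

lemma partialX_of_notMem_tsupport (hφ : ContDiff ℝ 1 φ) {z : ℝ × ℝ} (hz : z ∉ tsupport φ) :
    partialX φ z = 0 := by
  rw [partialX_eq hφ]
  simp [fderiv_of_notMem_tsupport (𝕜 := ℝ) hz]

lemma hasCompactSupport_partialT (hφ : ContDiff ℝ 1 φ) (hc : HasCompactSupport φ) :
    HasCompactSupport (partialT φ) :=
  HasCompactSupport.intro hc fun _ hz => partialT_of_notMem_tsupport hφ hz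

lemma hasCompactSupport_partialX (hφ : ContDiff ℝ 1 φ) (hc : HasCompactSupport φ) :
    HasCompactSupport (partialX φ) :=
  HasCompactSupport.intro hc fun _ hz => partialX_of_notMem_tsupport hφ hz

lemma partialT_mul (hφ : ContDiff ℝ 1 φ) (hψ : ContDiff ℝ 1 ψ) (z : ℝ × ℝ) :
    partialT (fun z => φ z * ψ z) z = partialT φ z * ψ z + φ z * partialT ψ z := by
  have := ((hasDerivAt_partialT hφ z).mul (hasDerivAt_partialT hψ z)).deriv
  rw [partialT_eq hφ, partialT_eq hψ]
  exact this

lemma partialX_mul (hφ : ContDiff ℝ 1 φ) (hψ : ContDiff ℝ 1 ψ) (z : ℝ × ℝ) :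
    partialX (fun z => φ z * ψ z) z = partialX φ z * ψ z + φ z * partialX ψ z := by
  have := ((hasDerivAt_partialX hφ z).mul (hasDerivAt_partialX hψ z)).deriv
  rw [partialX_eq hφ, partialX_eq hψ]
  exact this

lemma partialT_const_sub (w z : ℝ × ℝ) :
    partialT (fun z => φ (w - z)) z = -partialT φ (w - z) :=
  deriv_comp_const_sub (f := fun t => φ (t, w.2 - z.2)) w.1 z.1

lemma partialX_const_sub (w z : ℝ × ℝ) :
    partialX (fun z => φ (w - z)) z = -partialX φ (w - z) :=
  deriv_comp_const_sub (f := fun x => φ (w.1 - z.1, x)) w.2 z.2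

lemma partialT_const_mul_sub_const (c : ℝ) (w z : ℝ × ℝ) :
    partialT (fun w => c * φ (w - z)) w = c * partialT φ (w - z) := by
  have := deriv_comp_sub_const (f := fun t => φ (t, w.2 - z.2)) z.1 w.1
  exact (deriv_const_mul_field c).trans (congrArg (c * ·) this)

lemma partialX_const_mul_sub_const (c : ℝ) (w z : ℝ × ℝ) :
    partialX (fun w => c * φ (w - z)) w = c * partialX φ (w - z) := by
  have := deriv_comp_sub_const (f := fun x => φ (w.1 - z.1, x)) z.2 w.2
  exact (deriv_const_mul_field c).trans (congrArg (c * ·) this)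

end Partial

/-! ### Doubling of variables -/

section Doubling

/-- The integrand of Kružkov's entropy inequality for the function `a`, the flux `f` and the
source `g`, with constant `k` and test function `φ`. -/
noncomputable def kruzkovIntegrand (f : ℝ → ℝ) (a g : ℝ × ℝ → ℝ) (k : ℝ) (φ : ℝ × ℝ → ℝ)
    (z : ℝ × ℝ) : ℝ :=
  |a z - k| * partialT φ z + (f (a z) - f k) * Real.sign (a z - k) * partialX φ z
    + g z * Real.sign (a z - k) * φ z

/-- `a` satisfies on the open set `U` all Kružkov entropy inequalities of `a_t + f(a)_x = g`. The
existence of the integrals is not part of this definition: it follows from the boundedness of `a`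
and the local integrability of `g`, which are assumed wherever it is used. -/
def IsKruzkovSolution (f : ℝ → ℝ) (a g : ℝ × ℝ → ℝ) (U : Set (ℝ × ℝ)) : Prop :=
  ∀ (k : ℝ) (φ : ℝ × ℝ → ℝ), ContDiff ℝ 1 φ → HasCompactSupport φ → tsupport φ ⊆ U →
    (∀ z, 0 ≤ φ z) → 0 ≤ ∫ z, kruzkovIntegrand f a g k φ z

/-- The integrand of the Kato inequality that compares two solutions `a`, `b` with sources
`ga`, `gb`; the entropy flux is `f (max a b) - f (min a b) = sign (a - b) (f a - f b)`. The two
points `z`, `w` are those at which `a` and `b` are evaluated. -/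
noncomputable def katoIntegrand (f : ℝ → ℝ) (a b ga gb Ψ : ℝ × ℝ → ℝ) (z w : ℝ × ℝ) : ℝ :=
  |a z - b w| * partialT Ψ z + (f (max (a z) (b w)) - f (min (a z) (b w))) * partialX Ψ z
    + |ga z - gb w| * Ψ z

lemma sub_mul_sign_eq (f : ℝ → ℝ) (p q : ℝ) :
    (f p - f q) * Real.sign (p - q) = f (max p q) - f (min p q) := by
  rcases lt_trichotomy p q with h | h | h
  · rw [Real.sign_of_neg (by linarith), max_eq_right h.le, min_eq_left h.le]; ring
  · subst h; simp
  · rw [Real.sign_of_pos (by linarith), max_eq_left h.le, min_eq_right h.le]; ring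

lemma abs_sign_le_one (r : ℝ) : |Real.sign r| ≤ 1 := by
  rcases Real.sign_apply_eq r with h | h | h <;> simp [h]

lemma measurable_sign : Measurable Real.sign := by
  unfold Real.sign
  exact Measurable.ite measurableSet_Iio measurable_const
    (Measurable.ite measurableSet_Ioi measurable_const measurable_const)

variable {f : ℝ → ℝ} {a b ga gb Ψ ρ : ℝ × ℝ → ℝ} {U : Set (ℝ × ℝ)} {M : ℝ} {Λ : ℝ≥0}

lemma integrable_mul_comp_sub {p q : ℝ × ℝ → ℝ} (hp : Integrable p) (hq : Integrable q) :
    Integrable fun x : (ℝ × ℝ) × (ℝ × ℝ) => p x.1 * q (x.2 - x.1) := by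
  have h := (measurePreserving_prod_neg_add (volume : Measure (ℝ × ℝ))
    (volume : Measure (ℝ × ℝ))).integrable_comp_of_integrable (hp.mul_prod hq)
  refine h.congr (ae_of_all _ fun x => ?_)
  simp [Function.comp, sub_eq_neg_add]

lemma integrable_bdd_mul_mul_comp_sub {p q : ℝ × ℝ → ℝ} {m : (ℝ × ℝ) × (ℝ × ℝ) → ℝ} {c : ℝ}
    (hm : Measurable m) (hc : ∀ x, |m x| ≤ c) (hp : Integrable p) (hq : Integrable q) :
    Integrable fun x : (ℝ × ℝ) × (ℝ × ℝ) => m x * (p x.1 * q (x.2 - x.1)) :=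
  (integrable_mul_comp_sub hp hq).bdd_mul hm.aestronglyMeasurable (ae_of_all _ hc)

open scoped Pointwise in
/-- The version of `integrable_bdd_mul_mul_comp_sub` for a factor `g` of the second variable that is
only locally integrable. -/
lemma integrable_bdd_mul_snd_mul_comp_sub {g : ℝ × ℝ → ℝ} {m : (ℝ × ℝ) × (ℝ × ℝ) → ℝ} {c : ℝ}
    (hm : Measurable m) (hc : ∀ x, |m x| ≤ c) (hg : LocallyIntegrable g) (hΨ : Continuous Ψ)
    (hΨc : HasCompactSupport Ψ) (hρ : Continuous ρ) (hρc : HasCompactSupport ρ) :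
    Integrable fun x : (ℝ × ℝ) × (ℝ × ℝ) => m x * (g x.2 * (Ψ x.1 * ρ (x.2 - x.1))) := by
  set S := tsupport Ψ + tsupport ρ with hS
  have hSc : IsCompact S := hΨc.isCompact.add hρc.isCompact
  set g1 := S.indicator g with hg1
  have hg1i : Integrable g1 := (hg.integrableOn_isCompact hSc).integrable_indicator
    hSc.isClosed.measurableSet
  have hρi : Integrable (fun z => ρ (-z)) :=
    (hρ.integrable_of_hasCompactSupport hρc : Integrable ρ volume).comp_neg
  have h := (integrable_mul_comp_sub hg1i hρi).swap
  obtain ⟨C, hC⟩ := hΨ.bounded_above_of_compact_support hΨc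
  have h2 := h.bdd_mul (c := c * C) (f := fun x => m x * Ψ x.1)
    (hm.mul (hΨ.measurable.comp measurable_fst)).aestronglyMeasurable
    (ae_of_all _ fun x => by
      rw [norm_mul]
      exact mul_le_mul (hc x) (hC _) (norm_nonneg _) ((abs_nonneg _).trans (hc x)))
  refine h2.congr (ae_of_all _ fun x => ?_)
  simp only [Function.comp_apply, Prod.swap, neg_sub]
  by_cases hz : x.1 ∈ tsupport Ψ
  · by_cases hw : x.2 - x.1 ∈ tsupport ρ
    · have : x.2 ∈ S := ⟨x.1, hz, x.2 - x.1, hw, by simp⟩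
      simp only [hg1, indicator_of_mem this]
      ring
    · simp [image_eq_zero_of_notMem_tsupport hw]
  · simp [image_eq_zero_of_notMem_tsupport hz]


lemma abs_flux_sub_le (hf : LipschitzOnWith Λ f (Icc (-M) M)) {p q : ℝ} (hp : |p| ≤ M)
    (hq : |q| ≤ M) : |f (max p q) - f (min p q)| ≤ Λ * (M + M) := by
  have h1 := abs_le.1 hp
  have h2 := abs_le.1 hq
  have := hf.dist_le_mul (max p q) ⟨le_max_of_le_left h1.1, max_le h1.2 h2.2⟩
    (min p q) ⟨le_min h1.1 h2.1, min_le_of_left_le h1.2⟩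
  refine (Real.dist_eq _ _ ▸ this).trans (mul_le_mul_of_nonneg_left ?_ Λ.2)
  rw [Real.dist_eq, max_sub_min_eq_abs', abs_abs]
  exact (abs_sub _ _).trans (add_le_add hp hq)

lemma abs_flux_sub_flux_sub_le (hf : LipschitzOnWith Λ f (Icc (-M) M)) {p q r : ℝ} (hp : |p| ≤ M)
    (hq : |q| ≤ M) (hr : |r| ≤ M) :
    |(f (max p q) - f (min p q)) - (f (max p r) - f (min p r))| ≤ 2 * Λ * |q - r| := by
  have h1 := abs_le.1 hp
  have h2 := abs_le.1 hq
  have h3 := abs_le.1 hr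
  have e1 := hf.dist_le_mul (max p q) ⟨le_max_of_le_left h1.1, max_le h1.2 h2.2⟩
    (max p r) ⟨le_max_of_le_left h1.1, max_le h1.2 h3.2⟩
  have e2 := hf.dist_le_mul (min p q) ⟨le_min h1.1 h2.1, min_le_of_left_le h1.2⟩
    (min p r) ⟨le_min h1.1 h3.1, min_le_of_left_le h1.2⟩
  simp only [Real.dist_eq] at e1 e2
  have l1 : |max p q - max p r| ≤ |q - r| := by
    have := abs_max_sub_max_le_abs q r p
    rwa [max_comm q, max_comm r] at this
  have l2 : |min p q - min p r| ≤ |q - r| := by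
    have := abs_min_sub_min_le_max p q p r
    simpa using this
  calc _ = |(f (max p q) - f (max p r)) - (f (min p q) - f (min p r))| := by congr 1; ring
    _ ≤ |f (max p q) - f (max p r)| + |f (min p q) - f (min p r)| := abs_sub _ _
    _ ≤ Λ * |q - r| + Λ * |q - r| := add_le_add
        (e1.trans (mul_le_mul_of_nonneg_left l1 Λ.2)) (e2.trans (mul_le_mul_of_nonneg_left l2 Λ.2))
    _ = _ := by ring

lemma abs_mul_sign_le {p q : ℝ} (r : ℝ) (h : |p| ≤ q) : |p * Real.sign r| ≤ q := by
  rw [abs_mul]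
  exact (mul_le_of_le_one_right (abs_nonneg _) (abs_sign_le_one r)).trans h

/-- Hypotheses on the two solutions under which the doubling of variables is carried out. -/
structure DoublingData (f : ℝ → ℝ) (a b ga gb : ℝ × ℝ → ℝ) (M : ℝ) (Λ : ℝ≥0) : Prop where
  continuous_flux : Continuous f
  lipschitz_flux : LipschitzOnWith Λ f (Icc (-M) M)
  measurable_left : Measurable a
  measurable_right : Measurable b
  bound_left : ∀ z, |a z| ≤ M
  bound_right : ∀ z, |b z| ≤ M
  source_left : LocallyIntegrable ga
  source_right : LocallyIntegrable gb

section

variable (h : DoublingData f a b ga gb M Λ)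
  (hΨ : ContDiff ℝ 1 Ψ) (hΨc : HasCompactSupport Ψ) (hΨ0 : ∀ z, 0 ≤ Ψ z)
  (hρ : ContDiff ℝ 1 ρ) (hρc : HasCompactSupport ρ) (hρ0 : ∀ z, 0 ≤ ρ z)

include h in
lemma DoublingData.measurable_abs_sub :
    Measurable fun x : (ℝ × ℝ) × (ℝ × ℝ) => |a x.1 - b x.2| :=
  ((h.measurable_left.comp measurable_fst).sub (h.measurable_right.comp measurable_snd)).abs

include h in
lemma DoublingData.abs_abs_sub_le (x : (ℝ × ℝ) × (ℝ × ℝ)) : |(|a x.1 - b x.2|)| ≤ M + M := by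
  rw [abs_abs]
  exact (abs_sub _ _).trans (add_le_add (h.bound_left _) (h.bound_right _))

include h in
lemma DoublingData.measurable_flux :
    Measurable fun x : (ℝ × ℝ) × (ℝ × ℝ) =>
      f (max (a x.1) (b x.2)) - f (min (a x.1) (b x.2)) :=
  (h.continuous_flux.measurable.comp
    ((h.measurable_left.comp measurable_fst).max (h.measurable_right.comp measurable_snd))).sub
  (h.continuous_flux.measurable.comp
    ((h.measurable_left.comp measurable_fst).min (h.measurable_right.comp measurable_snd)))

include h in
lemma DoublingData.measurable_sign :
    Measurable fun x : (ℝ × ℝ) × (ℝ × ℝ) => Real.sign (a x.1 - b x.2) :=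
  PerBalance.measurable_sign.comp
    ((h.measurable_left.comp measurable_fst).sub (h.measurable_right.comp measurable_snd))

include h hΨ hΨc hρ hρc in
lemma DoublingData.integrable_left :
    Integrable fun x : (ℝ × ℝ) × (ℝ × ℝ) =>
      kruzkovIntegrand f a ga (b x.2) (fun z => Ψ z * ρ (x.2 - z)) x.1 := by
  have iΨ : Integrable Ψ volume := hΨ.continuous.integrable_of_hasCompactSupport hΨc
  have iρ : Integrable ρ volume := hρ.continuous.integrable_of_hasCompactSupport hρc
  have iΨt : Integrable (partialT Ψ) volume :=
    (continuous_partialT hΨ).integrable_of_hasCompactSupport (hasCompactSupport_partialT hΨ hΨc)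
  have iΨx : Integrable (partialX Ψ) volume :=
    (continuous_partialX hΨ).integrable_of_hasCompactSupport (hasCompactSupport_partialX hΨ hΨc)
  have iρt : Integrable (partialT ρ) volume :=
    (continuous_partialT hρ).integrable_of_hasCompactSupport (hasCompactSupport_partialT hρ hρc)
  have iρx : Integrable (partialX ρ) volume :=
    (continuous_partialX hρ).integrable_of_hasCompactSupport (hasCompactSupport_partialX hρ hρc)
  have ig : Integrable (fun z => ga z * Ψ z) :=
    LocallyIntegrable.integrable_mul_compactSupport h.source_left hΨ.continuous hΨc
  have hF := fun x : (ℝ × ℝ) × (ℝ × ℝ) =>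
    abs_flux_sub_le h.lipschitz_flux (h.bound_left x.1) (h.bound_right x.2)
  have t1 := integrable_bdd_mul_mul_comp_sub h.measurable_abs_sub h.abs_abs_sub_le iΨt iρ
  have t2 := integrable_bdd_mul_mul_comp_sub h.measurable_abs_sub h.abs_abs_sub_le iΨ iρt
  have t3 := integrable_bdd_mul_mul_comp_sub h.measurable_flux hF iΨx iρ
  have t4 := integrable_bdd_mul_mul_comp_sub h.measurable_flux hF iΨ iρx
  have t5 := integrable_bdd_mul_mul_comp_sub h.measurable_sign (fun x => abs_sign_le_one _) ig iρ
  refine ((((t1.sub t2).add t3).sub t4).add t5).congr (ae_of_all _ fun x => ?_)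
  have hρ' : ContDiff ℝ 1 fun z => ρ (x.2 - z) := hρ.comp (contDiff_const.sub contDiff_id)
  simp only [Pi.add_apply, Pi.sub_apply, kruzkovIntegrand, partialT_mul hΨ hρ', partialX_mul hΨ hρ',
    partialT_const_sub, partialX_const_sub, sub_mul_sign_eq]
  ring

include h hΨ hΨc hρ hρc in
lemma DoublingData.integrable_right :
    Integrable fun x : (ℝ × ℝ) × (ℝ × ℝ) =>
      kruzkovIntegrand f b gb (a x.1) (fun w => Ψ x.1 * ρ (w - x.1)) x.2 := by
  have iΨ : Integrable Ψ volume := hΨ.continuous.integrable_of_hasCompactSupport hΨc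
  have iρt : Integrable (partialT ρ) volume :=
    (continuous_partialT hρ).integrable_of_hasCompactSupport (hasCompactSupport_partialT hρ hρc)
  have iρx : Integrable (partialX ρ) volume :=
    (continuous_partialX hρ).integrable_of_hasCompactSupport (hasCompactSupport_partialX hρ hρc)
  have hF := fun x : (ℝ × ℝ) × (ℝ × ℝ) =>
    abs_flux_sub_le h.lipschitz_flux (h.bound_left x.1) (h.bound_right x.2)
  have t2 := integrable_bdd_mul_mul_comp_sub h.measurable_abs_sub h.abs_abs_sub_le iΨ iρt
  have t4 := integrable_bdd_mul_mul_comp_sub h.measurable_flux hF iΨ iρx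
  have t5 := integrable_bdd_mul_snd_mul_comp_sub h.measurable_sign (fun x => abs_sign_le_one _)
    h.source_right hΨ.continuous hΨc hρ.continuous hρc
  refine ((t2.add t4).sub t5).congr (ae_of_all _ fun x => ?_)
  have hs : Real.sign (b x.2 - a x.1) = -Real.sign (a x.1 - b x.2) := by
    rw [← Real.sign_neg, neg_sub]
  simp only [Pi.add_apply, Pi.sub_apply, kruzkovIntegrand, partialT_const_mul_sub_const,
    partialX_const_mul_sub_const, ← sub_mul_sign_eq f, hs, abs_sub_comm (b x.2)]
  ring

include h hΨ hΨc hρ hρc hΨ0 hρ0 in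
lemma DoublingData.integrable_kato :
    Integrable fun x : (ℝ × ℝ) × (ℝ × ℝ) =>
      katoIntegrand f a b ga gb Ψ x.1 x.2 * ρ (x.2 - x.1) := by
  have iρ : Integrable ρ volume := hρ.continuous.integrable_of_hasCompactSupport hρc
  have iΨt : Integrable (partialT Ψ) volume :=
    (continuous_partialT hΨ).integrable_of_hasCompactSupport (hasCompactSupport_partialT hΨ hΨc)
  have iΨx : Integrable (partialX Ψ) volume :=
    (continuous_partialX hΨ).integrable_of_hasCompactSupport (hasCompactSupport_partialX hΨ hΨc)
  have ig : Integrable (fun z => ga z * Ψ z) :=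
    LocallyIntegrable.integrable_mul_compactSupport h.source_left hΨ.continuous hΨc
  have hF := fun x : (ℝ × ℝ) × (ℝ × ℝ) =>
    abs_flux_sub_le h.lipschitz_flux (h.bound_left x.1) (h.bound_right x.2)
  have t1 := integrable_bdd_mul_mul_comp_sub h.measurable_abs_sub h.abs_abs_sub_le iΨt iρ
  have t3 := integrable_bdd_mul_mul_comp_sub h.measurable_flux hF iΨx iρ
  have t5 := (integrable_mul_comp_sub ig iρ).sub (integrable_bdd_mul_snd_mul_comp_sub
    (measurable_const (a := (1 : ℝ))) (fun _ => abs_one.le) h.source_right hΨ.continuous hΨc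
    hρ.continuous hρc)
  refine ((t1.add t3).add t5.norm).congr (ae_of_all _ fun x => ?_)
  have : ga x.1 * Ψ x.1 * ρ (x.2 - x.1) - 1 * (gb x.2 * (Ψ x.1 * ρ (x.2 - x.1))) =
    (ga x.1 - gb x.2) * (Ψ x.1 * ρ (x.2 - x.1)) := by ring
  simp only [Pi.add_apply, Pi.sub_apply, katoIntegrand, this, Real.norm_eq_abs, abs_mul,
    abs_of_nonneg (hΨ0 _), abs_of_nonneg (hρ0 _)]
  ring

include h hΨ hΨc hρ hρc hΨ0 hρ0 in
/-- Summing the inequality for `a` with constant `b w` and the inequality for `b` with constant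
`a z`, tested with `Ψ z * ρ (w - z)`, cancels the derivatives of `ρ`. -/
lemma DoublingData.integral_kato_nonneg (ha : IsKruzkovSolution f a ga U)
    (hb : IsKruzkovSolution f b gb U) (hΨU : tsupport Ψ ⊆ U)
    (hρU : ∀ z ∈ tsupport Ψ, ∀ y ∈ tsupport ρ, z + y ∈ U) :
    0 ≤ ∫ x : (ℝ × ℝ) × (ℝ × ℝ), katoIntegrand f a b ga gb Ψ x.1 x.2 * ρ (x.2 - x.1) := by
  have iA := h.integrable_left hΨ hΨc hρ hρc
  have iB := h.integrable_right hΨ hΨc hρ hρc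
  have iC := h.integrable_kato hΨ hΨc hΨ0 hρ hρc hρ0
  have hA : 0 ≤ ∫ x : (ℝ × ℝ) × (ℝ × ℝ),
      kruzkovIntegrand f a ga (b x.2) (fun z => Ψ z * ρ (x.2 - z)) x.1 := by
    rw [Measure.volume_eq_prod (ℝ × ℝ) (ℝ × ℝ)] at iA ⊢
    rw [integral_prod_symm _ iA]
    refine integral_nonneg fun w => ha (b w) (fun z => Ψ z * ρ (w - z))
      (hΨ.mul (hρ.comp (contDiff_const.sub contDiff_id)))
      hΨc.mul_right ((closure_mono fun z hz => ?_).trans hΨU) fun z => mul_nonneg (hΨ0 _) (hρ0 _)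
    exact left_ne_zero_of_mul hz
  have hB : 0 ≤ ∫ x : (ℝ × ℝ) × (ℝ × ℝ),
      kruzkovIntegrand f b gb (a x.1) (fun w => Ψ x.1 * ρ (w - x.1)) x.2 := by
    rw [Measure.volume_eq_prod (ℝ × ℝ) (ℝ × ℝ)] at iB ⊢
    rw [integral_prod _ iB]
    refine integral_nonneg fun z => ?_
    have hcs : HasCompactSupport fun w => ρ (w - z) :=
      hρc.comp_homeomorph (Homeomorph.subRight z)
    refine hb (a z) (fun w => Ψ z * ρ (w - z))
      (contDiff_const.mul (hρ.comp (contDiff_id.sub contDiff_const)))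
      hcs.mul_left ?_ fun w => mul_nonneg (hΨ0 _) (hρ0 _)
    by_cases hz : z ∈ tsupport Ψ
    · have h1 : tsupport (fun w => Ψ z * ρ (w - z)) ⊆ (fun w => w - z) ⁻¹' tsupport ρ :=
        closure_minimal (fun w hw => subset_tsupport _ (right_ne_zero_of_mul hw))
          ((isClosed_tsupport ρ).preimage (continuous_id.sub continuous_const))
      intro w hw
      simpa using hρU z hz _ (h1 hw)
    · simp [image_eq_zero_of_notMem_tsupport hz, tsupport]
  refine (add_nonneg hA hB).trans ?_
  rw [← integral_add iA iB]
  refine integral_mono (iA.add iB) iC fun x => ?_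
  have hρ' : ContDiff ℝ 1 fun z => ρ (x.2 - z) := hρ.comp (contDiff_const.sub contDiff_id)
  have hs : Real.sign (b x.2 - a x.1) = -Real.sign (a x.1 - b x.2) := by
    rw [← Real.sign_neg, neg_sub]
  simp only [kruzkovIntegrand, katoIntegrand, partialT_const_mul_sub_const,
    partialX_const_mul_sub_const, partialT_mul hΨ hρ', partialX_mul hΨ hρ',
    partialT_const_sub, partialX_const_sub, ← sub_mul_sign_eq f, hs, abs_sub_comm (b x.2)]
  have key : (ga x.1 - gb x.2) * Real.sign (a x.1 - b x.2) ≤ |ga x.1 - gb x.2| :=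
    (le_abs_self _).trans (abs_mul_sign_le _ le_rfl)
  have := mul_le_mul_of_nonneg_right key (mul_nonneg (hΨ0 x.1) (hρ0 (x.2 - x.1)))
  linear_combination this

end

end Doubling

section Kato

variable {f : ℝ → ℝ} {a b ga gb Ψ ρ : ℝ × ℝ → ℝ} {U : Set (ℝ × ℝ)} {M : ℝ} {Λ : ℝ≥0}

lemma LocallyIntegrable.abs {g : ℝ × ℝ → ℝ} (hg : LocallyIntegrable g) :
    LocallyIntegrable fun z => |g z| :=
  hg.mono hg.aestronglyMeasurable.norm (ae_of_all _ fun z => by simp)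

lemma DoublingData.integrable_kato_translate (h : DoublingData f a b ga gb M Λ)
    (hΨ : ContDiff ℝ 1 Ψ) (hΨc : HasCompactSupport Ψ) (y : ℝ × ℝ) :
    Integrable fun z => katoIntegrand f a b ga gb Ψ z (z + y) := by
  have hmap : Measurable fun z : ℝ × ℝ => (z, z + y) := by fun_prop
  have l1 := locallyIntegrable_of_bound (h.measurable_abs_sub.comp hmap)
    fun z => h.abs_abs_sub_le (z, z + y)
  have l2 := locallyIntegrable_of_bound (h.measurable_flux.comp hmap) fun z =>
    abs_flux_sub_le h.lipschitz_flux (h.bound_left z) (h.bound_right (z + y))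
  have l3 : LocallyIntegrable (fun z => |ga z - gb (z + y)|) :=
    LocallyIntegrable.abs (h.source_left.sub (LocallyIntegrable.comp_add_const h.source_right y))
  exact ((LocallyIntegrable.integrable_mul_compactSupport l1 (continuous_partialT hΨ)
    (hasCompactSupport_partialT hΨ hΨc)).add
    (LocallyIntegrable.integrable_mul_compactSupport l2 (continuous_partialX hΨ)
    (hasCompactSupport_partialX hΨ hΨc))).add
    (LocallyIntegrable.integrable_mul_compactSupport l3 hΨ.continuous hΨc)

lemma DoublingData.abs_kato_sub_le (h : DoublingData f a b ga gb M Λ) (z w w' : ℝ × ℝ) :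
    |katoIntegrand f a b ga gb Ψ z w - katoIntegrand f a b ga gb Ψ z w'| ≤
      |b w - b w'| * |partialT Ψ z| + 2 * Λ * (|b w - b w'| * |partialX Ψ z|)
        + |gb w - gb w'| * |Ψ z| := by
  have e1 : |(|a z - b w| - |a z - b w'|)| ≤ |b w - b w'| := by
    refine (abs_abs_sub_abs_le_abs_sub _ _).trans (le_of_eq ?_)
    rw [abs_sub_comm]; congr 1; ring
  have e3 : |(|ga z - gb w| - |ga z - gb w'|)| ≤ |gb w - gb w'| := by
    refine (abs_abs_sub_abs_le_abs_sub _ _).trans (le_of_eq ?_)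
    rw [abs_sub_comm]; congr 1; ring
  have e2 := abs_flux_sub_flux_sub_le h.lipschitz_flux (h.bound_left z) (h.bound_right w)
    (h.bound_right w')
  have : katoIntegrand f a b ga gb Ψ z w - katoIntegrand f a b ga gb Ψ z w' =
      (|a z - b w| - |a z - b w'|) * partialT Ψ z
      + ((f (max (a z) (b w)) - f (min (a z) (b w)))
        - (f (max (a z) (b w')) - f (min (a z) (b w')))) * partialX Ψ z
      + (|ga z - gb w| - |ga z - gb w'|) * Ψ z := by
    simp only [katoIntegrand]; ring
  rw [this]
  refine (abs_add_le _ _).trans (add_le_add ((abs_add_le _ _).trans (add_le_add ?_ ?_)) ?_)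
  · rw [abs_mul]; gcongr
  · rw [abs_mul, ← mul_assoc]; gcongr
  · rw [abs_mul]; gcongr

lemma DoublingData.tendsto_integral_kato (h : DoublingData f a b ga gb M Λ)
    (hΨ : ContDiff ℝ 1 Ψ) (hΨc : HasCompactSupport Ψ) :
    Tendsto (fun y => ∫ z, katoIntegrand f a b ga gb Ψ z (z + y)) (𝓝 0)
      (𝓝 (∫ z, katoIntegrand f a b ga gb Ψ z z)) := by
  have lb : LocallyIntegrable b := locallyIntegrable_of_bound h.measurable_right h.bound_right
  have ct := continuous_partialT hΨ
  have cx := continuous_partialX hΨ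
  have st := hasCompactSupport_partialT hΨ hΨc
  have sx := hasCompactSupport_partialX hΨ hΨc
  have t1 := tendsto_integral_mul_norm_translate_sub lb ct st
  have t2 := tendsto_integral_mul_norm_translate_sub lb cx sx
  have t3 := tendsto_integral_mul_norm_translate_sub h.source_right hΨ.continuous hΨc
  have int : ∀ {g θ : ℝ × ℝ → ℝ}, LocallyIntegrable g → Continuous θ → HasCompactSupport θ →
      ∀ y, Integrable fun z => |g (z + y) - g z| * |θ z| := fun hg hθ hθc y =>
    LocallyIntegrable.integrable_mul_compactSupport
      (LocallyIntegrable.abs ((LocallyIntegrable.comp_add_const hg y).sub hg)) hθ.abs hθc.norm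
  rw [tendsto_iff_norm_sub_tendsto_zero]
  have hsum := (t1.add (t2.const_mul (2 * (Λ : ℝ)))).add t3
  simp only [mul_zero, add_zero] at hsum
  refine squeeze_zero (fun _ => norm_nonneg _) (fun y => ?_) hsum
  have i0 := h.integrable_kato_translate hΨ hΨc 0
  simp only [add_zero] at i0
  have i12 : Integrable fun z => |b (z + y) - b z| * |partialT Ψ z|
      + 2 * Λ * (|b (z + y) - b z| * |partialX Ψ z|) :=
    (int lb ct st y).add ((int lb cx sx y).const_mul _)
  have i3 := int h.source_right hΨ.continuous hΨc y
  rw [← integral_sub (h.integrable_kato_translate hΨ hΨc y) i0, ← integral_const_mul,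
    ← integral_add (int lb ct st y) ((int lb cx sx y).const_mul _), ← integral_add i12 i3]
  exact norm_integral_le_of_norm_le (i12.add i3)
    (ae_of_all _ fun z => h.abs_kato_sub_le z (z + y) z)

/-- **Kato inequality**: two Kružkov solutions with sources `ga`, `gb` satisfy
`∂ₜ|a - b| + ∂ₓ (sign (a - b) (f a - f b)) ≤ |ga - gb|` in the sense of distributions. -/
theorem DoublingData.kato (h : DoublingData f a b ga gb M Λ) (hU : IsOpen U)
    (ha : IsKruzkovSolution f a ga U) (hb : IsKruzkovSolution f b gb U)
    (hΨ : ContDiff ℝ 1 Ψ) (hΨc : HasCompactSupport Ψ) (hΨ0 : ∀ z, 0 ≤ Ψ z)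
    (hΨU : tsupport Ψ ⊆ U) : 0 ≤ ∫ z, katoIntegrand f a b ga gb Ψ z z := by
  by_contra! hneg
  set J : ℝ × ℝ → ℝ := fun y => ∫ z, katoIntegrand f a b ga gb Ψ z (z + y) with hJ
  -- The doubled inequality reads `0 ≤ ∫ J y * ρ y`. If `J 0 < 0`, then `J < c < 0` near `0`, and a
  -- bump `ρ` concentrated there gives a contradiction.
  set c := (∫ z, katoIntegrand f a b ga gb Ψ z z) / 2 with hc
  have hc0 : c < 0 := by linarith
  obtain ⟨r, hr, hrJ⟩ := Metric.eventually_nhds_iff_ball.1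
    ((h.tendsto_integral_kato hΨ hΨc).eventually (gt_mem_nhds (show _ < c by linarith)))
  obtain ⟨δ, hδ, hδU⟩ := hΨc.isCompact.exists_cthickening_subset_open hU hΨU
  have hmin : 0 < min r δ / 2 := half_pos (lt_min hr hδ)
  let B : ContDiffBump (0 : ℝ × ℝ) := ⟨min r δ / 4, min r δ / 2, by linarith, by linarith⟩
  have hBc : HasCompactSupport B := B.hasCompactSupport
  have hB1 : ContDiff ℝ 1 B := B.contDiff
  have hint := h.integrable_kato hΨ hΨc hΨ0 hB1 hBc fun z => B.nonneg
  have hpos := h.integral_kato_nonneg hΨ hΨc hΨ0 hB1 hBc (fun z => B.nonneg) ha hb hΨU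
    fun z hz y hy => hδU (Metric.mem_cthickening_of_dist_le _ z δ _ hz (by
      rw [B.tsupport_eq, mem_closedBall_zero_iff] at hy
      simp only [dist_self_add_left]
      exact hy.trans (by linarith [min_le_right r δ, show B.rOut = min r δ / 2 from rfl])))
  have hint2 : Integrable (fun x : (ℝ × ℝ) × (ℝ × ℝ) =>
      katoIntegrand f a b ga gb Ψ x.1 (x.1 + x.2) * B x.2) (volume.prod volume) := by
    have := (measurePreserving_prod_add (volume : Measure (ℝ × ℝ))
      (volume : Measure (ℝ × ℝ))).integrable_comp_of_integrable hint
    simpa only [Function.comp_def, add_sub_cancel_left] using this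
  rw [Measure.volume_eq_prod (ℝ × ℝ) (ℝ × ℝ)] at hpos hint
  have hJB : ∫ y, J y * B y = ∫ x : (ℝ × ℝ) × (ℝ × ℝ),
      katoIntegrand f a b ga gb Ψ x.1 x.2 * B (x.2 - x.1) ∂(volume.prod volume) := by
    rw [integral_prod _ hint]
    calc ∫ y, J y * B y = ∫ y, ∫ z, katoIntegrand f a b ga gb Ψ z (z + y) * B y := by
          simp_rw [integral_mul_const, hJ]
      _ = ∫ z, ∫ y, katoIntegrand f a b ga gb Ψ z (z + y) * B y :=
          (integral_integral_swap (f := fun z y => katoIntegrand f a b ga gb Ψ z (z + y) * B y)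
            hint2).symm
      _ = _ := by
          congr 1
          ext z
          simpa using integral_add_left_eq_self
            (fun w => katoIntegrand f a b ga gb Ψ z w * B (w - z)) z
  rw [← hJB] at hpos
  have iJB : Integrable fun y => J y * B y := by
    simpa only [integral_mul_const] using hint2.integral_prod_right
  have hle : ∫ y, J y * B y ≤ ∫ y, c * B y := by
    refine integral_mono iJB (B.integrable.const_mul c) fun y => ?_
    by_cases hy : y ∈ Metric.ball 0 r
    · exact mul_le_mul_of_nonneg_right (hrJ y hy).le B.nonneg
    · have : B y = 0 := B.zero_of_le_dist (by
        have h1 : r ≤ dist y 0 := not_lt.1 hy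
        have h2 := min_le_left r δ
        change min r δ / 2 ≤ _
        linarith)
      simp [this]
  rw [integral_const_mul] at hle
  exact absurd (hpos.trans hle) (not_le.2 (mul_neg_of_neg_of_pos hc0 B.integral_pos))

end Kato

/-! ### Translates of periodic functions of bounded variation -/

section Variation

lemma lintegral_Ioc_periodic {p : ℝ} (hp : 0 < p) {F : ℝ → ℝ≥0∞} (hF : Function.Periodic F p)
    (a b : ℝ) : ∫⁻ x in Ioc a (a + p), F x = ∫⁻ x in Ioc b (b + p), F x := by
  have : ∀ (g : AddSubgroup.zmultiples p) (x : ℝ), F (g +ᵥ x) = F x := by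
    rintro ⟨g, n, rfl⟩ x
    simpa [AddSubgroup.vadd_def, add_comm] using hF.zsmul n x
  exact (isAddFundamentalDomain_Ioc hp a).setLIntegral_eq (isAddFundamentalDomain_Ioc hp b) F this

lemma integral_translate_sub_le_of_monotoneOn {p q y : ℝ} {V : ℝ → ℝ}
    (hV : MonotoneOn V (Icc p q)) (hy : 0 ≤ y) (hyq : p + y ≤ q) :
    IntervalIntegrable (fun x => V (x + y) - V x) volume p (q - y) ∧
    ∫ x in p..(q - y), (V (x + y) - V x) ≤ y * (V q - V p) := by
  have hpq : p ≤ q := by linarith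
  have int : ∀ {c d : ℝ}, p ≤ c → c ≤ d → d ≤ q → IntervalIntegrable V volume c d := by
    intro c d hc hcd hd
    refine MonotoneOn.intervalIntegrable ?_
    rw [uIcc_of_le hcd]
    exact hV.mono (Icc_subset_Icc hc hd)
  have i1 : IntervalIntegrable (fun x => V (x + y)) volume p (q - y) := by
    have := (int (c := p + y) (d := q) (by linarith) hyq le_rfl).comp_add_right y
    simpa using this
  have i2 := int (c := p) (d := q - y) le_rfl (by linarith) (by linarith)
  refine ⟨i1.sub i2, ?_⟩
  rw [intervalIntegral.integral_sub i1 i2, intervalIntegral.integral_comp_add_right, sub_add_cancel]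
  have e1 := intervalIntegral.integral_add_adjacent_intervals
    (int (c := p) (d := p + y) le_rfl (by linarith) hyq)
    (int (c := p + y) (d := q) (by linarith) hyq le_rfl)
  have e2 := intervalIntegral.integral_add_adjacent_intervals
    i2 (int (c := q - y) (d := q) (by linarith) (by linarith) le_rfl)
  have b1 : ∫ x in (q - y)..q, V x ≤ y * V q := by
    have := intervalIntegral.integral_mono_on (by linarith)
      (int (c := q - y) (d := q) (by linarith) (by linarith) le_rfl)
      (intervalIntegrable_const (c := V q)) fun x hx =>
        hV ⟨by linarith [hx.1], hx.2⟩ ⟨hpq, le_rfl⟩ hx.2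
    simpa using this
  have b2 : y * V p ≤ ∫ x in p..(p + y), V x := by
    have := intervalIntegral.integral_mono_on (by linarith)
      (intervalIntegrable_const (c := V p))
      (int (c := p) (d := p + y) le_rfl (by linarith) hyq) fun x hx =>
        hV ⟨le_rfl, hpq⟩ ⟨hx.1, by linarith [hx.2]⟩ hx.1
    simpa using this
  linarith

/-- The `L¹` modulus of continuity of `w` over a period `2P` is at most `β y`. -/
def TranslationBound (P β : ℝ) (w : ℝ → ℝ) : Prop :=
  ∀ y ∈ Ioo 0 (2 * P), ∫⁻ x in Ioc (-P) P, ‖w (x + y) - w x‖ₑ ≤ ENNReal.ofReal (β * y)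

/-- A function that is almost everywhere equal on a period to a function of variation at most `β`
has `L¹` modulus of continuity `2 β y`: one half comes from the interior of the period, the other
from the jump between two periods. -/
lemma translationBound_of_eVariationOn_le {P : ℝ} {β : ℝ≥0} {w h : ℝ → ℝ}
    (hw : Function.Periodic w (2 * P))
    (hwh : ∀ᵐ x, x ∈ Icc (-P) P → h x = w x) (hh : eVariationOn h (Icc (-P) P) ≤ β) :
    TranslationBound P (2 * β) w := by
  intro y hy
  have hbv : LocallyBoundedVariationOn h (Icc (-P) P) :=
    BoundedVariationOn.locallyBoundedVariationOn (hh.trans_lt ENNReal.coe_lt_top).ne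
  have hP : -P ≤ P := by linarith [hy.1, hy.2]
  set V := variationOnFromTo h (Icc (-P) P) (-P) with hV
  have hleft : -P ∈ Icc (-P) P := left_mem_Icc.2 hP
  have hright : P ∈ Icc (-P) P := right_mem_Icc.2 hP
  have hVm : MonotoneOn V (Icc (-P) P) := variationOnFromTo.monotoneOn hbv hleft
  have hV0 : V (-P) = 0 := variationOnFromTo.self _ _ _
  have hVP : V P ≤ β := by
    rw [hV, variationOnFromTo.eq_of_le _ _ hP, inter_self]
    exact ENNReal.toReal_le_coe_of_le_coe hh
  have hVd : ∀ x ∈ Icc (-P) P, ∀ x' ∈ Icc (-P) P, x ≤ x' → |h x' - h x| ≤ V x' - V x := by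
    intro x hx x' hx' hxx
    have e := variationOnFromTo.add hbv hleft hx hx'
    have e3 : |h x' - h x| ≤ variationOnFromTo h (Icc (-P) P) x x' := by
      rw [variationOnFromTo.eq_of_le _ _ hxx, ← Real.dist_eq]
      have h1 : edist (h x') (h x) ≤ eVariationOn h (Icc (-P) P ∩ Icc x x') :=
        eVariationOn.edist_le _ ⟨hx', hxx, le_rfl⟩ ⟨hx, le_rfl, hxx⟩
      rw [edist_dist] at h1
      exact (ENNReal.ofReal_le_iff_le_toReal (hbv x x' hx hx')).1 h1
    linarith
  have hd : ∀ x ∈ Icc (-P) P, ∀ x' ∈ Icc (-P) P, |h x' - h x| ≤ β := by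
    intro x hx x' hx'
    have hb : ∀ x ∈ Icc (-P) P, 0 ≤ V x ∧ V x ≤ β := fun x hx =>
      ⟨hV0 ▸ hVm hleft hx hx.1, (hVm hx hright hx.2).trans hVP⟩
    rcases le_total x x' with hle | hle
    · linarith [hVd x hx x' hx' hle, hb x hx, hb x' hx']
    · rw [abs_sub_comm]
      linarith [hVd x' hx' x hx hle, hb x hx, hb x' hx']
  have hsplit : Ioc (-P) P = Ioc (-P) (P - y) ∪ Ioc (P - y) P :=
    (Ioc_union_Ioc_eq_Ioc (by linarith [hy.2]) (by linarith [hy.1])).symm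
  have hshift : ∀ c : ℝ, ∀ᵐ x, x + c ∈ Icc (-P) P → h (x + c) = w (x + c) := fun c =>
    (quasiMeasurePreserving_add_right volume c).ae hwh
  rw [hsplit]
  refine (lintegral_union_le _ _ _).trans ?_
  -- Both `x` and `x + y` lie in the period; the increments of the variation function telescope.
  have h1 : ∫⁻ x in Ioc (-P) (P - y), ‖w (x + y) - w x‖ₑ ≤ ENNReal.ofReal (β * y) := by
    obtain ⟨hi, hle⟩ := integral_translate_sub_le_of_monotoneOn hVm hy.1.le (by linarith [hy.2])
    have : ∫⁻ x in Ioc (-P) (P - y), ‖w (x + y) - w x‖ₑ ≤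
        ∫⁻ x in Ioc (-P) (P - y), ENNReal.ofReal (V (x + y) - V x) := by
      refine lintegral_mono_ae ?_
      refine (ae_restrict_iff' measurableSet_Ioc).2 ?_
      filter_upwards [hwh, hshift y] with x e1 e2 hx
      have m1 : x ∈ Icc (-P) P := ⟨hx.1.le, by linarith [hx.2, hy.1]⟩
      have m2 : x + y ∈ Icc (-P) P := ⟨by linarith [hx.1, hy.1], by linarith [hx.2]⟩
      rw [← e1 m1, ← e2 m2, Real.enorm_eq_ofReal_abs]
      exact ENNReal.ofReal_le_ofReal (hVd x m1 _ m2 (by linarith [hy.1]))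
    refine this.trans ?_
    rw [← ofReal_integral_eq_lintegral_ofReal hi.1, ← intervalIntegral.integral_of_le
      (by linarith [hy.2])]
    · refine ENNReal.ofReal_le_ofReal (hle.trans ?_)
      rw [hV0, mul_comm]
      exact mul_le_mul_of_nonneg_right (by linarith) hy.1.le
    · refine (ae_restrict_iff' measurableSet_Ioc).2 ?_
      refine ae_of_all _ fun x hx => sub_nonneg.2 (hVm ⟨hx.1.le, by linarith [hx.2, hy.1]⟩
        ⟨by linarith [hx.1, hy.1], by linarith [hx.2]⟩ (by linarith [hy.1]))
  -- Here `x + y` lies in the next period; the difference is at most the total variation `β`, and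
  -- the interval has length `y`.
  have h2 : ∫⁻ x in Ioc (P - y) P, ‖w (x + y) - w x‖ₑ ≤ ENNReal.ofReal (β * y) := by
    have : ∫⁻ x in Ioc (P - y) P, ‖w (x + y) - w x‖ₑ ≤ ∫⁻ x in Ioc (P - y) P, (β : ℝ≥0∞) := by
      refine lintegral_mono_ae ?_
      refine (ae_restrict_iff' measurableSet_Ioc).2 ?_
      filter_upwards [hwh, hshift (y - 2 * P)] with x e1 e2 hx
      have m1 : x ∈ Icc (-P) P := ⟨by linarith [hx.1, hy.2], hx.2⟩
      have m2 : x + (y - 2 * P) ∈ Icc (-P) P :=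
        ⟨by linarith [hx.1], by linarith [hx.2, hy.2]⟩
      have e3 : w (x + y) = w (x + (y - 2 * P)) := by
        rw [← hw (x + (y - 2 * P))]; congr 1; ring
      rw [e3, ← e1 m1, ← e2 m2, Real.enorm_eq_ofReal_abs, ENNReal.ofReal_le_iff_le_toReal
        ENNReal.coe_ne_top]
      exact hd x m1 _ m2
    refine this.trans ?_
    rw [lintegral_const, Measure.restrict_apply_univ, Real.volume_Ioc, sub_sub_cancel,
      ENNReal.ofReal_mul β.coe_nonneg, ENNReal.ofReal_coe_nnreal]
  refine (add_le_add h1 h2).trans (le_of_eq ?_)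
  rw [← ENNReal.ofReal_add (mul_nonneg β.coe_nonneg hy.1.le) (mul_nonneg β.coe_nonneg hy.1.le)]
  congr 1
  ring

lemma TranslationBound.sub {P β γ : ℝ} {w w' : ℝ → ℝ} (hw : TranslationBound P β w)
    (hw' : TranslationBound P γ w') (hβ : 0 ≤ β) (hγ : 0 ≤ γ) (hm : Measurable w) :
    TranslationBound P (β + γ) (fun x => w x - w' x) := by
  intro y hy
  have : ∀ x, ‖w (x + y) - w' (x + y) - (w x - w' x)‖ₑ ≤
      ‖w (x + y) - w x‖ₑ + ‖w' (x + y) - w' x‖ₑ := fun x => by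
    have e : w (x + y) - w' (x + y) - (w x - w' x) =
      (w (x + y) - w x) - (w' (x + y) - w' x) := by ring
    rw [e]
    exact enorm_sub_le
  refine (lintegral_mono this).trans ?_
  rw [lintegral_add_left (by fun_prop), add_mul,
    ENNReal.ofReal_add (mul_nonneg hβ hy.1.le) (mul_nonneg hγ hy.1.le)]
  exact add_le_add (hw y hy) (hw' y hy)

lemma TranslationBound.symm_diff_le {P β y : ℝ} {w : ℝ → ℝ} (hw : TranslationBound P β w)
    (hper : Function.Periodic w (2 * P)) (hy : y ∈ Ioo 0 P) :
    ∫⁻ x in Ioc (-P) P, ‖w (x - y) - w (x + y)‖ₑ ≤ ENNReal.ofReal (2 * β * y) := by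
  have hP : 0 < P := hy.1.trans hy.2
  set F : ℝ → ℝ≥0∞ := fun x => ‖w (x - y) - w (x + y)‖ₑ with hF
  have hFp : Function.Periodic F (2 * P) := fun x => by
    simp only [hF]
    rw [show x + 2 * P - y = x - y + 2 * P by ring, show x + 2 * P + y = x + y + 2 * P by ring,
      hper, hper]
  have e1 : ∫⁻ x in Ioc (-P) P, F x = ∫⁻ x in Ioc (-P + y) (P + y), F x := by
    have := lintegral_Ioc_periodic (by linarith) hFp (-P) (-P + y)
    rwa [show -P + 2 * P = P by ring, show -P + y + 2 * P = P + y by ring] at this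
  have e2 : ∫⁻ x in Ioc (-P + y) (P + y), F x = ∫⁻ x in Ioc (-P) P, F (x + y) := by
    have := (measurePreserving_add_right (volume : Measure ℝ) y).setLIntegral_comp_preimage_emb
      (measurableEmbedding_addRight y) F (Ioc (-P + y) (P + y))
    rw [← this]
    simp
  rw [e1, e2]
  have := hw (2 * y) ⟨by linarith [hy.1], by linarith [hy.2]⟩
  rw [show 2 * β * y = β * (2 * y) by ring]
  refine le_trans (le_of_eq (lintegral_congr fun x => ?_)) this
  simp only [hF, add_sub_cancel_right]
  rw [← enorm_neg, neg_sub, show x + y + y = x + 2 * y by ring]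

end Variation

/-! ### The singular integral of a periodic function of bounded variation -/

section SingularIntegral

/-- The kernel restricted to the positive half `(0, P]` of the period. -/
noncomputable def halfKernel (P : ℝ) (K : ℝ → ℝ) : ℝ → ℝ := (Ioc 0 P).indicator K

/-- The singular integral with the oddness of the kernel used to pair `y` and `-y`. On functions of
bounded variation it converges absolutely at almost every point. -/
noncomputable def symmIntegral (P : ℝ) (K w : ℝ → ℝ) (x : ℝ) : ℝ :=
  ∫ y, halfKernel P K y * (w (x - y) - w (x + y))

/-- The integral of the absolute values in `symmIntegral`. -/
noncomputable def symmLIntegral (P : ℝ) (K w : ℝ → ℝ) (x : ℝ) : ℝ≥0∞ :=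
  ∫⁻ y, ‖halfKernel P K y * (w (x - y) - w (x + y))‖ₑ

variable {P C : ℝ} {K w w' : ℝ → ℝ}

lemma Ioc_subset_offLattice : Ioc 0 P ⊆ offLattice P := by
  intro x hx n hn
  have hP : 0 < P := hx.1.trans_le hx.2
  have h1 : (0 : ℝ) < n := by
    by_contra! h
    have : 2 * P * n ≤ 0 := mul_nonpos_of_nonneg_of_nonpos (by linarith) h
    linarith [hx.1]
  have h2 : (1 : ℝ) ≤ n := by
    exact_mod_cast Int.add_one_le_iff.2 (by exact_mod_cast h1 : (0 : ℤ) < n)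
  have : 2 * P * 1 ≤ 2 * P * n := mul_le_mul_of_nonneg_left h2 (by linarith)
  linarith [hx.2]

lemma KernelCondition.measurable_halfKernel (hK : KernelCondition P K) :
    Measurable (halfKernel P K) := by
  classical
  have h := ((hK.contDiffOn.continuousOn).mono
    (Ioc_subset_offLattice (P := P))).measurable_piecewise (g := fun _ => (0 : ℝ))
    continuousOn_const measurableSet_Ioc
  rwa [show (Ioc 0 P).piecewise K (fun _ => 0) = halfKernel P K from
    piecewise_eq_indicator (f := K)] at h

lemma halfKernel_of_mem {y : ℝ} (hy : y ∈ Ioc 0 P) : halfKernel P K y = K y :=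
  indicator_of_mem hy K

lemma halfKernel_of_notMem {y : ℝ} (hy : y ∉ Ioc 0 P) : halfKernel P K y = 0 :=
  indicator_of_notMem hy K

lemma measurable_symmIntegral (hK : Measurable (halfKernel P K)) {a : ℝ × ℝ → ℝ}
    (ha : Measurable a) :
    Measurable fun z : ℝ × ℝ => symmIntegral P K (fun x => a (z.1, x)) z.2 := by
  have : StronglyMeasurable fun q : (ℝ × ℝ) × ℝ =>
      halfKernel P K q.2 * (a (q.1.1, q.1.2 - q.2) - a (q.1.1, q.1.2 + q.2)) := by
    refine Measurable.stronglyMeasurable ?_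
    fun_prop
  exact this.integral_prod_right'.measurable

lemma measurable_symmLIntegral (hK : Measurable (halfKernel P K)) {a : ℝ × ℝ → ℝ}
    (ha : Measurable a) :
    Measurable fun z : ℝ × ℝ => symmLIntegral P K (fun x => a (z.1, x)) z.2 := by
  have : Measurable fun q : (ℝ × ℝ) × ℝ =>
      ‖halfKernel P K q.2 * (a (q.1.1, q.1.2 - q.2) - a (q.1.1, q.1.2 + q.2))‖ₑ := by
    fun_prop
  exact this.lintegral_prod_right'

lemma enorm_symmIntegral_le (x : ℝ) : ‖symmIntegral P K w x‖ₑ ≤ symmLIntegral P K w x :=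
  enorm_integral_le_lintegral_enorm _

lemma periodic_symmIntegral (hw : Function.Periodic w (2 * P)) :
    Function.Periodic (symmIntegral P K w) (2 * P) := fun x => by
  simp only [symmIntegral]
  congr 1
  ext y
  rw [show x + 2 * P - y = x - y + 2 * P by ring, show x + 2 * P + y = x + y + 2 * P by ring,
    hw, hw]

lemma periodic_symmLIntegral (hw : Function.Periodic w (2 * P)) :
    Function.Periodic (symmLIntegral P K w) (2 * P) := fun x => by
  simp only [symmLIntegral]
  congr 1
  ext y
  rw [show x + 2 * P - y = x - y + 2 * P by ring, show x + 2 * P + y = x + y + 2 * P by ring,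
    hw, hw]

lemma integrable_of_symmLIntegral_ne_top (hK : Measurable (halfKernel P K)) (hw : Measurable w)
    {x : ℝ} (hx : symmLIntegral P K w x ≠ ∞) :
    Integrable fun y => halfKernel P K y * (w (x - y) - w (x + y)) :=
  ⟨by fun_prop, lt_top_iff_ne_top.2 hx⟩

lemma symmIntegral_sub (hK : Measurable (halfKernel P K)) (hw : Measurable w)
    (hw' : Measurable w') {x : ℝ} (hx : symmLIntegral P K w x ≠ ∞)
    (hx' : symmLIntegral P K w' x ≠ ∞) :
    symmIntegral P K w x - symmIntegral P K w' x =
      symmIntegral P K (fun x => w x - w' x) x := by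
  simp only [symmIntegral]
  rw [← integral_sub (integrable_of_symmLIntegral_ne_top hK hw hx)
    (integrable_of_symmLIntegral_ne_top hK hw' hx')]
  congr 1
  ext y
  ring

lemma lintegral_inv_Ioc {δ : ℝ} (hδ : 0 < δ) (hδP : δ ≤ P) {c : ℝ} (hc : 0 ≤ c) :
    ∫⁻ y in Ioc δ P, ENNReal.ofReal (c / y) = ENNReal.ofReal (c * Real.log (P / δ)) := by
  have hP := hδ.trans_le hδP
  have hi : IntervalIntegrable (fun y : ℝ => c / y) volume δ P := by
    refine ContinuousOn.intervalIntegrable (continuousOn_const.div continuousOn_id fun y hy => ?_)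
    rw [uIcc_of_le hδP] at hy
    exact (hδ.trans_le hy.1).ne'
  rw [← ofReal_integral_eq_lintegral_ofReal hi.1, ← intervalIntegral.integral_of_le hδP]
  · congr 1
    simp_rw [div_eq_mul_inv c]
    rw [intervalIntegral.integral_const_mul, integral_inv_of_pos hδ hP]
  · refine (ae_restrict_iff' measurableSet_Ioc).2 (ae_of_all _ fun y hy => ?_)
    exact div_nonneg hc (hδ.trans hy.1).le

/-- The logarithmic bound for the singular integral on `L¹`: the near part `|y| ≤ δ` is controlled
by the translation bound, the far part by the `L¹` norm. -/
lemma lintegral_symmLIntegral_le {β δ m : ℝ} (hK : Measurable (halfKernel P K))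
    (hC0 : 0 ≤ C) (hC : ∀ y ∈ Ioc 0 P, |K y| ≤ C / y) (hw : Measurable w)
    (hper : Function.Periodic w (2 * P)) (hβ : 0 ≤ β) (hwβ : TranslationBound P β w)
    (hδ : 0 < δ) (hδP : δ ≤ P) (hm0 : 0 ≤ m)
    (hm : ∫⁻ x in Ioc (-P) P, ‖w x‖ₑ ≤ ENNReal.ofReal m) :
    ∫⁻ x in Ioc (-P) P, symmLIntegral P K w x ≤
      ENNReal.ofReal (2 * C * β * δ + 2 * C * m * Real.log (P / δ)) := by
  have hP := hδ.trans_le hδP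
  have hmeas : Measurable fun q : ℝ × ℝ =>
      ‖halfKernel P K q.2 * (w (q.1 - q.2) - w (q.1 + q.2))‖ₑ := by fun_prop
  simp only [symmLIntegral]
  rw [lintegral_lintegral_swap hmeas.aemeasurable]
  have hk : ∀ y ∈ Ioc 0 P, ‖halfKernel P K y‖ₑ ≤ ENNReal.ofReal (C / y) := fun y hy => by
    rw [halfKernel_of_mem hy, Real.enorm_eq_ofReal_abs]
    exact ENNReal.ofReal_le_ofReal (hC y hy)
  have hfac : ∀ y, ∫⁻ x in Ioc (-P) P, ‖halfKernel P K y * (w (x - y) - w (x + y))‖ₑ =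
      ‖halfKernel P K y‖ₑ * ∫⁻ x in Ioc (-P) P, ‖w (x - y) - w (x + y)‖ₑ := fun y => by
    simp_rw [enorm_mul]
    rw [lintegral_const_mul _ (by fun_prop)]
  have hshift : ∀ y, ∫⁻ x in Ioc (-P) P, ‖w (x + y)‖ₑ ≤ ENNReal.ofReal m := fun y => by
    have e2 := (measurePreserving_add_right (volume : Measure ℝ) y).setLIntegral_comp_preimage_emb
      (measurableEmbedding_addRight y) (fun x => ‖w x‖ₑ) (Ioc (-P + y) (P + y))
    have e1 := lintegral_Ioc_periodic (F := fun x => ‖w x‖ₑ) (p := 2 * P) (by linarith)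
      (fun x => by simp only [hper x]) (-P + y) (-P)
    rw [show -P + 2 * P = P by ring, show -P + y + 2 * P = P + y by ring] at e1
    rw [e1] at e2
    simp only [preimage_add_const_Ioc, add_sub_cancel_right] at e2
    exact e2.le.trans hm
  have hfar : ∀ y, ∫⁻ x in Ioc (-P) P, ‖w (x - y) - w (x + y)‖ₑ ≤ ENNReal.ofReal (2 * m) :=
    fun y => by
      refine (lintegral_mono fun x => enorm_sub_le).trans ?_
      rw [lintegral_add_left (by fun_prop), two_mul, ENNReal.ofReal_add hm0 hm0]
      exact add_le_add (by simpa only [sub_eq_add_neg] using hshift (-y)) (hshift y)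
  have hsub : ∫⁻ y, ∫⁻ x in Ioc (-P) P, ‖halfKernel P K y * (w (x - y) - w (x + y))‖ₑ =
      ∫⁻ y in Ioc 0 P, ∫⁻ x in Ioc (-P) P, ‖halfKernel P K y * (w (x - y) - w (x + y))‖ₑ := by
    refine (setLIntegral_eq_of_support_subset fun y hy => ?_).symm
    by_contra h
    exact hy (by simp [halfKernel_of_notMem h])
  rw [hsub, ← Ioc_union_Ioc_eq_Ioc hδ.le hδP]
  refine (lintegral_union_le _ _ _).trans ?_
  rw [ENNReal.ofReal_add (by positivity)
    (mul_nonneg (by positivity) (Real.log_nonneg ((one_le_div hδ).2 hδP)))]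
  refine add_le_add ?_ ?_
  · have h1 : ∫⁻ y in Ioc 0 δ, ∫⁻ x in Ioc (-P) P,
        ‖halfKernel P K y * (w (x - y) - w (x + y))‖ₑ ≤
        ∫⁻ y in Ioc 0 δ, ENNReal.ofReal (2 * C * β) := by
      refine lintegral_mono_ae ((ae_restrict_iff' measurableSet_Ioc).2 ?_)
      filter_upwards [(show ∀ᵐ y : ℝ, y ≠ P from compl_mem_ae_iff.2 (measure_singleton P))]
        with y hyP hy
      have hy' : y ∈ Ioo 0 P := ⟨hy.1, lt_of_le_of_ne (hy.2.trans hδP) hyP⟩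
      rw [hfac]
      refine (mul_le_mul' (hk y ⟨hy'.1, hy'.2.le⟩) (hwβ.symm_diff_le hper hy')).trans ?_
      rw [← ENNReal.ofReal_mul (div_nonneg hC0 hy.1.le)]
      refine le_of_eq (congrArg _ ?_)
      have := hy.1.ne'
      field_simp
    refine h1.trans (le_of_eq ?_)
    rw [lintegral_const, Measure.restrict_apply_univ, Real.volume_Ioc, sub_zero,
      ← ENNReal.ofReal_mul (by positivity)]
  · have h2 : ∫⁻ y in Ioc δ P, ∫⁻ x in Ioc (-P) P,
        ‖halfKernel P K y * (w (x - y) - w (x + y))‖ₑ ≤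
        ∫⁻ y in Ioc δ P, ENNReal.ofReal (2 * C * m / y) := by
      refine lintegral_mono_ae ((ae_restrict_iff' measurableSet_Ioc).2 (ae_of_all _ fun y hy => ?_))
      have hy0 : 0 < y := hδ.trans hy.1
      rw [hfac]
      refine (mul_le_mul' (hk y ⟨hy0, hy.2⟩) (hfar y)).trans ?_
      rw [← ENNReal.ofReal_mul (div_nonneg hC0 hy0.le)]
      refine le_of_eq (congrArg _ ?_)
      ring
    exact h2.trans (le_of_eq (lintegral_inv_Ioc hδ hδP (by positivity)))

/-- Where the symmetric integral converges absolutely, it is the principal value. -/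
lemma KernelCondition.Gper_eq_symmIntegral (hK : KernelCondition P K) (hP : 0 < P)
    (hw : Measurable w) {M : ℝ} (hM : ∀ x, |w x| ≤ M) {x : ℝ}
    (hx : symmLIntegral P K w x ≠ ∞) : Gper P K w x = symmIntegral P K w x := by
  have hkm := hK.measurable_halfKernel
  obtain ⟨C, hC0, hC⟩ := hK.bound
  have hint := integrable_of_symmLIntegral_ne_top hkm hw hx
  set F : ℝ → ℝ := fun y => halfKernel P K y * (w (x - y) - w (x + y)) with hF
  have hlim : Tendsto (fun ε : ℝ => ∫ y, (Ioi ε).indicator F y) (𝓝[>] 0) (𝓝 (∫ y, F y)) := by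
    refine tendsto_integral_filter_of_dominated_convergence (fun y => ‖F y‖)
      (Eventually.of_forall fun ε => hint.aestronglyMeasurable.indicator measurableSet_Ioi)
      (Eventually.of_forall fun ε => ae_of_all _ fun y => norm_indicator_le_norm_self _ _)
      hint.norm (ae_of_all _ fun y => ?_)
    by_cases hy : 0 < y
    · refine tendsto_const_nhds.congr' ?_
      filter_upwards [mem_nhdsWithin_of_mem_nhds (Iio_mem_nhds hy)] with ε hε
      exact (indicator_of_mem (show y ∈ Ioi ε from hε) F).symm
    · have h0 : F y = 0 := by simp [hF, halfKernel_of_notMem fun h : y ∈ Ioc 0 P => hy h.1]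
      have : ∀ ε : ℝ, (Ioi ε).indicator F y = 0 := fun ε => by
        by_cases h : y ∈ Ioi ε
        · rw [indicator_of_mem h, h0]
        · exact indicator_of_notMem h F
      simp only [this, h0]
      exact tendsto_const_nhds
  refine (hlim.congr' ?_).limUnder_eq
  filter_upwards [Ioo_mem_nhdsGT hP] with ε hε
  -- The truncated integral consists of `y ≥ ε` and `y ≤ -ε`; the latter is reflected.
  have hset : Ioo (-P) P \ Ioo (-ε) ε = Ioc (-P) (-ε) ∪ Ico ε P := by
    ext y
    simp only [Set.mem_sdiff, mem_Ioo, mem_union, mem_Ioc, mem_Ico, not_and, not_lt]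
    constructor
    · rintro ⟨⟨h1, h2⟩, h3⟩
      by_cases h : -ε < y
      · exact Or.inr ⟨h3 h, h2⟩
      · exact Or.inl ⟨h1, not_lt.1 h⟩
    · rintro (⟨h1, h2⟩ | ⟨h1, h2⟩)
      · exact ⟨⟨h1, by linarith [hε.1, hε.2]⟩, fun h => by linarith⟩
      · exact ⟨⟨by linarith [hε.1], h2⟩, fun _ => h1⟩
  have hbd : ∀ y ∈ Ioc ε P, ‖halfKernel P K y‖ ≤ C / ε := fun y hy => by
    have hy0 : 0 < y := hε.1.trans hy.1
    rw [halfKernel_of_mem ⟨hy0, hy.2⟩]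
    refine ((hC y ⟨by linarith, hy.2⟩ hy0.ne').1).trans ?_
    rw [abs_of_pos hy0]
    exact div_le_div_of_nonneg_left hC0.le hε.1 hy.1.le
  have hi : ∀ v : ℝ → ℝ, Measurable v → (∀ y, |v y| ≤ M) →
      IntervalIntegrable (fun y => halfKernel P K y * v y) volume ε P := by
    intro v hv hvM
    rw [intervalIntegrable_iff_integrableOn_Ioc_of_le hε.2.le]
    refine Measure.integrableOn_of_bounded (M := C / ε * M) (by simp) (by fun_prop)
      ((ae_restrict_iff' measurableSet_Ioc).2 (ae_of_all _ fun y hy => ?_))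
    rw [norm_mul]
    exact mul_le_mul (hbd y hy) (hvM y) (norm_nonneg _) (div_nonneg hC0.le hε.1.le)
  have i1 := hi (fun y => w (x - y)) (by fun_prop) fun y => hM _
  have i2 := hi (fun y => w (x + y)) (by fun_prop) fun y => hM _
  have c1 : ∀ y ∈ Ioc ε P, halfKernel P K y * w (x - y) = K y * w (x - y) := fun y hy => by
    rw [halfKernel_of_mem ⟨hε.1.trans hy.1, hy.2⟩]
  have c2 : ∀ y ∈ Ioc ε P, -(halfKernel P K y * w (x + y)) = K (-y) * w (x - -y) := fun y hy => by
    have hy' : y ∈ Ioc 0 P := ⟨hε.1.trans hy.1, hy.2⟩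
    rw [halfKernel_of_mem hy', hK.odd y (Ioc_subset_offLattice hy'), sub_neg_eq_add, neg_mul]
  have j1 : IntervalIntegrable (fun y => K y * w (x - y)) volume ε P :=
    i1.congr fun y hy => c1 y (by rwa [uIoc_of_le hε.2.le] at hy)
  have j2 : IntervalIntegrable (fun y => K (-y) * w (x - -y)) volume ε P :=
    i2.neg.congr fun y hy => c2 y (by rwa [uIoc_of_le hε.2.le] at hy)
  have j3 : IntervalIntegrable (fun y => K y * w (x - y)) volume (-P) (-ε) := by
    have := ((IntervalIntegrable.iff_comp_neg).1 j2).symm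
    simpa using this
  have L : ∫ y, (Ioi ε).indicator F y = ∫ y in ε..P, F y := by
    rw [integral_indicator measurableSet_Ioi, intervalIntegral.integral_of_le hε.2.le,
      ← Ioc_union_Ioi_eq_Ioi hε.2.le]
    refine setIntegral_eq_of_subset_of_forall_sdiff_eq_zero
      (measurableSet_Ioc.union measurableSet_Ioi) subset_union_left fun y hy => ?_
    have : y ∉ Ioc 0 P := fun h => hy.2 ((hy.1.resolve_right fun h' => not_lt.2 h.2 h'))
    simp [hF, halfKernel_of_notMem this]
  have R1 : ∫ y in Ioc (-P) (-ε), K y * w (x - y) = ∫ y in ε..P, K (-y) * w (x - -y) := by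
    rw [← intervalIntegral.integral_of_le (by linarith [hε.2]),
      intervalIntegral.integral_comp_neg (fun y => K y * w (x - y))]
  have R2 : ∫ y in Ico ε P, K y * w (x - y) = ∫ y in ε..P, K y * w (x - y) := by
    rw [integral_Ico_eq_integral_Ioc, intervalIntegral.integral_of_le hε.2.le]
  rw [L, hset, setIntegral_union, R1, R2, add_comm, ← intervalIntegral.integral_add j1 j2]
  · refine intervalIntegral.integral_congr_uIoo fun y hy => ?_
    rw [uIoo_of_le hε.2.le] at hy
    have hy' : y ∈ Ioc ε P := ⟨hy.1, hy.2.le⟩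
    simp only [hF]
    rw [← c1 y hy', ← c2 y hy']
    ring
  · exact Set.disjoint_left.2 fun y h1 h2 => by linarith [h1.2, h2.1, hε.1]
  · exact measurableSet_Ico
  · exact (intervalIntegrable_iff_integrableOn_Ioc_of_le (by linarith [hε.2])).1 j3
  · rw [integrableOn_Ico_iff_integrableOn_Ioo, ← integrableOn_Ioc_iff_integrableOn_Ioo]
    exact ((intervalIntegrable_iff_integrableOn_Ioc_of_le hε.2.le).1 j1)

end SingularIntegral

/-! ### Bounds that are uniform in time -/

section TimeBounds

variable {P : ℝ}

/-- `L²` continuity in time on the bounded interval `[-P, P]` implies `L¹` continuity. -/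
lemma tendsto_integral_abs_sub {u : ℝ → ℝ → ℝ}
    (hu : ∀ t, 0 ≤ t → MemLp (u t) 2 (volume.restrict (Icc (-P) P)))
    (hc : ∀ t₀ : ℝ, 0 ≤ t₀ →
      Tendsto (fun t => eLpNorm (fun x => u t x - u t₀ x) 2 (volume.restrict (Icc (-P) P)))
        (𝓝[Ici 0] t₀) (𝓝 0)) {t₀ : ℝ} (ht₀ : 0 ≤ t₀) :
    Tendsto (fun t => ∫ x in Icc (-P) P, |u t x - u t₀ x|) (𝓝[Ici 0] t₀) (𝓝 0) := by
  set μ := volume.restrict (Icc (-P) P)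
  set c := μ univ ^ (1 / (1 : ℝ≥0∞).toReal - 1 / (2 : ℝ≥0∞).toReal) with hcdef
  have hcfin : c ≠ ∞ := ENNReal.rpow_ne_top_of_nonneg (by norm_num) (measure_ne_top _ _)
  have h1 := ENNReal.Tendsto.mul_const (b := c) (hc t₀ ht₀) (Or.inr hcfin)
  rw [zero_mul] at h1
  have h2 : Tendsto (fun t => eLpNorm (fun x => u t x - u t₀ x) 1 μ) (𝓝[Ici 0] t₀) (𝓝 0) := by
    refine tendsto_of_tendsto_of_tendsto_of_le_of_le' tendsto_const_nhds h1
      (Eventually.of_forall fun _ => zero_le) ?_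
    filter_upwards [self_mem_nhdsWithin] with t ht
    exact eLpNorm_le_eLpNorm_mul_rpow_measure_univ (by norm_num)
      ((hu t ht).sub (hu t₀ ht₀)).aestronglyMeasurable
  have h3 := (ENNReal.tendsto_toReal ENNReal.zero_ne_top).comp h2
  rw [ENNReal.toReal_zero] at h3
  refine h3.congr' ?_
  filter_upwards [self_mem_nhdsWithin] with t ht
  have hm : AEStronglyMeasurable (fun x => u t x - u t₀ x) μ :=
    ((hu t ht).sub (hu t₀ ht₀)).aestronglyMeasurable
  simp only [Function.comp_apply, ← Real.norm_eq_abs]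
  rw [integral_norm_eq_lintegral_enorm hm, eLpNorm_one_eq_lintegral_enorm]

lemma continuousOn_integral_abs_sub {u v : ℝ → ℝ → ℝ}
    (hu : ∀ t, 0 ≤ t → MemLp (u t) 2 (volume.restrict (Icc (-P) P)))
    (huc : ∀ t₀ : ℝ, 0 ≤ t₀ →
      Tendsto (fun t => eLpNorm (fun x => u t x - u t₀ x) 2 (volume.restrict (Icc (-P) P)))
        (𝓝[Ici 0] t₀) (𝓝 0))
    (hv : ∀ t, 0 ≤ t → MemLp (v t) 2 (volume.restrict (Icc (-P) P)))
    (hvc : ∀ t₀ : ℝ, 0 ≤ t₀ →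
      Tendsto (fun t => eLpNorm (fun x => v t x - v t₀ x) 2 (volume.restrict (Icc (-P) P)))
        (𝓝[Ici 0] t₀) (𝓝 0)) :
    ContinuousOn (fun t => ∫ x in Icc (-P) P, |u t x - v t x|) (Ici 0) := by
  intro t₀ ht₀
  have ht₀' : 0 ≤ t₀ := ht₀
  have hsum := (tendsto_integral_abs_sub hu huc ht₀').add (tendsto_integral_abs_sub hv hvc ht₀')
  rw [add_zero] at hsum
  rw [ContinuousWithinAt, tendsto_iff_norm_sub_tendsto_zero]
  refine squeeze_zero' (Eventually.of_forall fun _ => norm_nonneg _) ?_ hsum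
  filter_upwards [self_mem_nhdsWithin] with t ht
  have I : ∀ {w w' : ℝ → ℝ}, MemLp w 2 (volume.restrict (Icc (-P) P)) →
      MemLp w' 2 (volume.restrict (Icc (-P) P)) →
      Integrable (fun x => |w x - w' x|) (volume.restrict (Icc (-P) P)) := fun hw hw' =>
    ((hw.sub hw').integrable (by norm_num)).norm
  rw [← integral_sub (I (hu t ht) (hv t ht)) (I (hu t₀ ht₀) (hv t₀ ht₀)),
    ← integral_add (I (hu t ht) (hu t₀ ht₀)) (I (hv t ht) (hv t₀ ht₀))]
  refine norm_integral_le_of_norm_le ((I (hu t ht) (hu t₀ ht₀)).add (I (hv t ht) (hv t₀ ht₀)))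
    (ae_of_all _ fun x => ?_)
  refine (abs_abs_sub_abs_le_abs_sub _ _).trans ?_
  rw [show u t x - v t x - (u t₀ x - v t₀ x) = (u t x - u t₀ x) - (v t x - v t₀ x) by ring]
  exact abs_sub _ _

lemma ae_forall_int_periodic {g : ℝ → ℝ} {p : ℝ} (hg : ∀ᵐ x, g (x + p) = g x) :
    ∀ᵐ x, ∀ n : ℤ, g (x + n * p) = g x := by
  have h : ∀ᵐ x, ∀ n : ℤ, g (x + n * p + p) = g (x + n * p) :=
    ae_all_iff.2 fun n => (quasiMeasurePreserving_add_right volume (n * p)).ae hg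
  filter_upwards [h] with x hx n
  induction n using Int.induction_on with
  | zero => simp
  | succ i ih =>
    have := hx i
    rw [ih] at this
    rw [← this]; push_cast; congr 1; ring
  | pred i ih =>
    have := hx (-i - 1)
    rw [← ih]
    push_cast at this ⊢
    rw [← this]; congr 1; ring

/-- The point of `[-P, P)` that is congruent to `x` modulo `2P`. -/
noncomputable def periodPoint (P x : ℝ) : ℝ := -P + Int.fract ((x + P) / (2 * P)) * (2 * P)

lemma measurable_periodPoint : Measurable (periodPoint P) := by
  unfold periodPoint
  fun_prop

lemma periodPoint_eq (hP : 0 < P) (x : ℝ) :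
    periodPoint P x = x + (-⌊(x + P) / (2 * P)⌋ : ℤ) * (2 * P) := by
  rw [periodPoint, Int.fract]
  push_cast
  field_simp
  ring

lemma periodPoint_mem (hP : 0 < P) (x : ℝ) : periodPoint P x ∈ Icc (-P) P := by
  have h0 := Int.fract_nonneg ((x + P) / (2 * P))
  have h1 := Int.fract_lt_one ((x + P) / (2 * P))
  constructor
  · have := mul_nonneg h0 (show (0 : ℝ) ≤ 2 * P by linarith)
    simp only [periodPoint]; linarith
  · have := mul_le_mul_of_nonneg_right h1.le (show (0 : ℝ) ≤ 2 * P by linarith)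
    simp only [periodPoint]; linarith

lemma periodPoint_periodic (hP : 0 < P) : Function.Periodic (periodPoint P) (2 * P) := fun x => by
  have : (x + 2 * P + P) / (2 * P) = (x + P) / (2 * P) + 1 := by field_simp; ring
  rw [periodPoint, this, Int.fract_add_one, periodPoint]

/-- An almost everywhere periodic function agrees almost everywhere with its periodization. -/
lemma ae_periodPoint {g : ℝ → ℝ} (hP : 0 < P) (hg : ∀ᵐ x, g (x + 2 * P) = g x) :
    ∀ᵐ x, g (periodPoint P x) = g x := by
  filter_upwards [ae_forall_int_periodic hg] with x hx
  rw [periodPoint_eq hP, hx]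

/-- A property that holds at almost all points of `[-P, P]` holds at `periodPoint P x` for almost
all `x`. -/
lemma ae_periodPoint_of_ae_Icc {p : ℝ → Prop} (hP : 0 < P) (hp : ∀ᵐ x, x ∈ Icc (-P) P → p x) :
    ∀ᵐ x, p (periodPoint P x) := by
  have h : ∀ᵐ x : ℝ, ∀ n : ℤ, x + n * (2 * P) ∈ Icc (-P) P → p (x + n * (2 * P)) :=
    ae_all_iff.2 fun n => (quasiMeasurePreserving_add_right volume (n * (2 * P))).ae hp
  filter_upwards [h] with x hx
  have := hx (-⌊(x + P) / (2 * P)⌋)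
  rw [← periodPoint_eq hP] at this
  exact this (periodPoint_mem hP x)

lemma exists_eVariationOn_le_of_totVar_le {g : ℝ → ℝ} {B : ℝ≥0} (h : totVar P g ≤ B) :
    ∃ w : ℝ → ℝ, (∀ᵐ x, x ∈ Icc (-P) P → w x = g x) ∧
      eVariationOn w (Icc (-P) P) ≤ ((B + 1 : ℝ≥0) : ℝ≥0∞) := by
  have : totVar P g < ((B + 1 : ℝ≥0) : ℝ≥0∞) :=
    h.trans_lt (ENNReal.coe_lt_coe.2 (lt_add_one B))
  obtain ⟨w, hw⟩ := iInf_lt_iff.1 this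
  obtain ⟨hwg, hw⟩ := iInf_lt_iff.1 hw
  exact ⟨w, (ae_restrict_iff' measurableSet_Icc).1 hwg, hw.le⟩

/-- The sup norm is bounded by the variation and the mean. -/
lemma ae_abs_le_of_totVar_le {g : ℝ → ℝ} {B : ℝ≥0} (hP : 0 < P) (h : totVar P g ≤ B)
    (hg : IntegrableOn g (Icc (-P) P)) :
    ∀ᵐ x, x ∈ Icc (-P) P → |g x| ≤ (B + 1) + (∫ y in Icc (-P) P, |g y|) / (2 * P) := by
  obtain ⟨w, hwg, hw⟩ := exists_eVariationOn_le_of_totVar_le h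
  have hd : ∀ x ∈ Icc (-P) P, ∀ y ∈ Icc (-P) P, |w x - w y| ≤ B + 1 := fun x hx y hy => by
    have := (eVariationOn.edist_le w hx hy).trans hw
    rw [edist_dist, Real.dist_eq, ENNReal.ofReal_le_iff_le_toReal ENNReal.coe_ne_top] at this
    exact this
  filter_upwards [hwg] with x hx hxm
  rw [← hx hxm]
  have hle : ∫ y in Icc (-P) P, (|w x| - (B + 1)) ≤ ∫ y in Icc (-P) P, |g y| := by
    refine setIntegral_mono_on_ae (by simp) hg.norm measurableSet_Icc ?_
    filter_upwards [hwg] with y hy hym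
    rw [← hy hym]
    have := hd x hxm y hym
    linarith [abs_sub_abs_le_abs_sub (w x) (w y)]
  rw [setIntegral_const, smul_eq_mul, Measure.real, Real.volume_Icc,
    ENNReal.toReal_ofReal (by linarith)] at hle
  have : |w x| - (B + 1) ≤ (∫ y in Icc (-P) P, |g y|) / (2 * P) := by
    rw [le_div_iff₀ (by linarith)]
    linarith
  linarith

end TimeBounds

/-! ### A Borel measurable, bounded, periodic representative of a solution -/

section Representative

variable {P T M : ℝ} {f K ubar : ℝ → ℝ} {u : ℝ → ℝ → ℝ} {a : ℝ × ℝ → ℝ}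

lemma IsEntropyWeakSolution.exists_forall_ae_abs_le (hP : 0 < P)
    (hu : IsEntropyWeakSolution P f K ubar u) {B : ℝ≥0}
    (hB : ∀ t ∈ Icc 0 T, totVar P (u t) ≤ B) :
    ∃ M : ℝ, ∀ t ∈ Icc 0 T, ∀ᵐ x, |u t x| ≤ M := by
  have hm : ∀ t, 0 ≤ t → MemLp (u t) 2 (volume.restrict (Icc (-P) P)) :=
    fun t ht => (hu.mem_L2per t ht).memLp
  have hcont := continuousOn_integral_abs_sub (v := fun _ _ => 0) hm hu.continuous
    (fun _ _ => MemLp.zero') (fun _ _ => by simpa using tendsto_const_nhds)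
  obtain ⟨N, hN⟩ := isCompact_Icc.exists_bound_of_continuousOn
    (hcont.mono (Icc_subset_Ici_self : Icc 0 T ⊆ Ici 0))
  refine ⟨(B + 1) + N / (2 * P), fun t ht => ?_⟩
  have h1 := ae_abs_le_of_totVar_le hP (hB t ht) ((hm t ht.1).integrable (by norm_num))
  have h2 := hN t ht
  simp only [sub_zero] at h2
  have h3 : ∫ y in Icc (-P) P, |u t y| ≤ N := (le_abs_self _).trans h2
  have h4 : (∫ y in Icc (-P) P, |u t y|) / (2 * P) ≤ N / (2 * P) := by gcongr
  filter_upwards [ae_periodPoint_of_ae_Icc hP h1, ae_periodPoint hP (hu.mem_L2per t ht.1).periodic]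
    with x hx1 hx2
  rw [← hx2]
  linarith

/-- `a` is, on the time interval `(0, T)`, a Borel measurable representative of `u` that is bounded
by `M` and exactly `2P`-periodic in space; outside `(0, T)` it vanishes. -/
structure IsPeriodicRep (P T M : ℝ) (u : ℝ → ℝ → ℝ) (a : ℝ × ℝ → ℝ) : Prop where
  measurable : Measurable a
  bound : ∀ z, |a z| ≤ M
  periodic : ∀ t, Function.Periodic (fun x => a (t, x)) (2 * P)
  zero : ∀ t ∉ Ioo 0 T, ∀ x, a (t, x) = 0
  ae_eq : ∀ᵐ z : ℝ × ℝ, z.1 ∈ Ioo 0 T → u z.1 z.2 = a z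
  ae_ae_eq : ∀ᵐ t : ℝ, t ∈ Ioo 0 T → ∀ᵐ x, u t x = a (t, x)

lemma exists_isPeriodicRep (hP : 0 < P)
    (hu : AEStronglyMeasurable (fun z : ℝ × ℝ => u z.1 z.2)
      (volume.restrict (Ioo 0 T ×ˢ (univ : Set ℝ))))
    (hper : ∀ t ∈ Ioo 0 T, ∀ᵐ x, u t (x + 2 * P) = u t x) (hM0 : 0 ≤ M)
    (hM : ∀ t ∈ Ioo 0 T, ∀ᵐ x, |u t x| ≤ M) : ∃ a, IsPeriodicRep P T M u a := by
  -- Clamping and periodizing change almost no value, since almost every slice of `U` is bounded by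
  -- `M` and periodic.
  set U : ℝ × ℝ → ℝ := hu.mk _ with hU
  have hUm : Measurable U := hu.stronglyMeasurable_mk.measurable
  have hprod : (volume.restrict (Ioo 0 T ×ˢ (univ : Set ℝ)) : Measure (ℝ × ℝ)) =
      (volume.restrict (Ioo 0 T)).prod volume := by
    rw [Measure.volume_eq_prod, ← Measure.prod_restrict, Measure.restrict_univ]
  have hUu : ∀ᵐ z ∂(volume.restrict (Ioo 0 T ×ˢ (univ : Set ℝ)) : Measure (ℝ × ℝ)),
      u z.1 z.2 = U z := hu.ae_eq_mk
  set a : ℝ × ℝ → ℝ := fun z =>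
    (Ioo 0 T).indicator (fun _ => max (-M) (min M (U (z.1, periodPoint P z.2)))) z.1 with ha
  have ham : Measurable a := by
    have : a = {z : ℝ × ℝ | z.1 ∈ Ioo 0 T}.indicator
        fun z => max (-M) (min M (U (z.1, periodPoint P z.2))) := by
      ext z
      simp only [ha, indicator, mem_ofPred_eq]
    rw [this]
    refine Measurable.indicator ?_ (measurable_fst measurableSet_Ioo)
    exact measurable_const.max (measurable_const.min (hUm.comp
      (measurable_fst.prodMk (measurable_periodPoint.comp measurable_snd))))
  have hslice : ∀ᵐ t ∂volume.restrict (Ioo 0 T), ∀ᵐ x, u t x = U (t, x) := by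
    rw [hprod] at hUu
    exact Measure.ae_ae_of_ae_prod hUu
  have hslice2 : ∀ᵐ t ∂volume.restrict (Ioo 0 T), ∀ᵐ x, U (t, x) = a (t, x) ∧ u t x = a (t, x) := by
    filter_upwards [hslice, ae_restrict_mem measurableSet_Ioo] with t ht htT
    have hUper : ∀ᵐ x, U (t, x + 2 * P) = U (t, x) := by
      filter_upwards [ht, (quasiMeasurePreserving_add_right volume (2 * P)).ae ht, hper t htT]
        with x h1 h2 h3
      rw [← h1, ← h3]
      exact h2.symm
    filter_upwards [ht, hM t htT, ae_periodPoint (g := fun x => U (t, x)) hP hUper] with x h1 h2 h3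
    have h4 := abs_le.1 h2
    have : a (t, x) = U (t, x) := by
      simp only [ha, indicator_of_mem htT]
      rw [h3, ← h1, min_eq_right h4.2, max_eq_right h4.1]
    exact ⟨this.symm, h1.trans this.symm⟩
  refine ⟨a, ham, fun z => ?_, fun t x => ?_, fun t ht x => ?_, ?_, ?_⟩
  · by_cases hz : z.1 ∈ Ioo 0 T
    · simp only [ha, indicator_of_mem hz]
      exact abs_le.2 ⟨le_max_left _ _, max_le (by linarith) (min_le_left _ _)⟩
    · simpa only [ha, indicator_of_notMem hz, abs_zero] using hM0
  · simp only [ha, periodPoint_periodic hP x]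
  · simp only [ha, indicator_of_notMem ht]
  · have hUa : ∀ᵐ z ∂(volume.restrict (Ioo 0 T ×ˢ (univ : Set ℝ)) : Measure (ℝ × ℝ)),
        U z = a z := by
      rw [hprod, Measure.ae_prod_iff_ae_ae (measurableSet_eq_fun hUm ham)]
      filter_upwards [hslice2] with t ht
      exact ht.mono fun x hx => hx.1
    have := hUu.and hUa
    rw [ae_restrict_iff' (measurableSet_Ioo.prod MeasurableSet.univ)] at this
    filter_upwards [this] with z hz hzT
    obtain ⟨h1, h2⟩ := hz ⟨hzT, mem_univ _⟩
    exact h1.trans h2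
  · rw [ae_restrict_iff' measurableSet_Ioo] at hslice2
    filter_upwards [hslice2] with t ht htT
    exact (ht htT).mono fun x hx => hx.2

/-- The source term that belongs to a representative. -/
noncomputable def repSource (P : ℝ) (K : ℝ → ℝ) (a : ℝ × ℝ → ℝ) (z : ℝ × ℝ) : ℝ :=
  symmIntegral P K (fun x => a (z.1, x)) z.2

namespace IsPeriodicRep

lemma ae_translationBound (ha : IsPeriodicRep P T M u a) {B : ℝ≥0}
    (hB : ∀ t ∈ Icc 0 T, totVar P (u t) ≤ B) :
    ∀ᵐ t, t ∈ Ioo 0 T → TranslationBound P (2 * (B + 1)) (fun x => a (t, x)) := by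
  filter_upwards [ha.ae_ae_eq] with t ht htT
  obtain ⟨w, hw, hwB⟩ := exists_eVariationOn_le_of_totVar_le (hB t (Ioo_subset_Icc_self htT))
  refine translationBound_of_eVariationOn_le (β := B + 1) (ha.periodic t) ?_ hwB
  filter_upwards [hw, ht htT] with x h1 h2 hx
  rw [h1 hx, h2]

lemma measurable_slice (ha : IsPeriodicRep P T M u a) (t : ℝ) : Measurable fun x => a (t, x) :=
  ha.measurable.comp measurable_prodMk_left

lemma integrableOn_slice (ha : IsPeriodicRep P T M u a) (t : ℝ) :
    IntegrableOn (fun x => a (t, x)) (Ioc (-P) P) :=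
  Measure.integrableOn_of_bounded (M := M) (by simp) (ha.measurable_slice t).aestronglyMeasurable
    (ae_of_all _ fun x => ha.bound (t, x))

/-- Slices have singular integrals bounded in `L¹`, uniformly in time. -/
lemma exists_ae_lintegral_le (ha : IsPeriodicRep P T M u a) (hP : 0 < P)
    (hK : KernelCondition P K) {B : ℝ≥0} (hB : ∀ t ∈ Icc 0 T, totVar P (u t) ≤ B) :
    ∃ D : ℝ≥0, ∀ᵐ t, ∀ c : ℝ,
      ∫⁻ x in Ioc c (c + 2 * P), symmLIntegral P K (fun x => a (t, x)) x ≤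
        (Ioo 0 T).indicator (fun _ => (D : ℝ≥0∞)) t := by
  obtain ⟨C, hC0, hC⟩ := hK.bound
  refine ⟨(2 * C * (2 * (B + 1)) * P).toNNReal, ?_⟩
  filter_upwards [ha.ae_translationBound hB] with t ht c
  by_cases htT : t ∈ Ioo 0 T
  · have h := lintegral_symmLIntegral_le (C := C) (δ := P) (m := ∫ x in Ioc (-P) P, ‖a (t, x)‖)
      hK.measurable_halfKernel hC0.le
      (fun y hy => by
        have := (hC y ⟨by linarith [hy.1], hy.2⟩ hy.1.ne').1
        rwa [abs_of_pos hy.1] at this)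
      (ha.measurable_slice t) (ha.periodic t) (by positivity) (ht htT) hP le_rfl
      (integral_nonneg fun _ => norm_nonneg _)
      (ofReal_integral_norm_eq_lintegral_enorm (ha.integrableOn_slice t)).ge
    rw [div_self hP.ne', Real.log_one, mul_zero, add_zero] at h
    rw [indicator_of_mem htT]
    have e := lintegral_Ioc_periodic (by linarith) (periodic_symmLIntegral (K := K) (ha.periodic t))
      c (-P)
    rw [show -P + 2 * P = P by ring] at e
    exact e.le.trans h
  · have h0 : ∀ x, symmLIntegral P K (fun x => a (t, x)) x = 0 := fun x => by
      simp [symmLIntegral, ha.zero t htT]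
    simp [h0]

lemma ae_symmLIntegral_ne_top (ha : IsPeriodicRep P T M u a) (hP : 0 < P)
    (hK : KernelCondition P K) {B : ℝ≥0} (hB : ∀ t ∈ Icc 0 T, totVar P (u t) ≤ B) :
    ∀ᵐ t, ∀ᵐ x, symmLIntegral P K (fun x => a (t, x)) x ≠ ∞ := by
  obtain ⟨D, hD⟩ := ha.exists_ae_lintegral_le hP hK hB
  have hmeas := measurable_symmLIntegral hK.measurable_halfKernel ha.measurable
  filter_upwards [hD] with t ht
  rw [← Measure.restrict_univ (μ := (volume : Measure ℝ)),
    ← iUnion_Ioc_add_zsmul (show 0 < 2 * P by linarith) 0, ae_restrict_iUnion_iff]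
  intro n
  have hfin : ∫⁻ x in Ioc (0 + n • (2 * P)) (0 + (n + 1) • (2 * P)),
      symmLIntegral P K (fun x => a (t, x)) x ≠ ∞ := by
    rw [add_smul, one_smul, ← add_assoc]
    refine ((ht _).trans_lt ?_).ne
    by_cases h : t ∈ Ioo 0 T <;> simp [h]
  filter_upwards [ae_lt_top (hmeas.comp measurable_prodMk_left) hfin] with x hx
  exact hx.ne

lemma locallyIntegrable_repSource (ha : IsPeriodicRep P T M u a) (hP : 0 < P)
    (hK : KernelCondition P K) {B : ℝ≥0} (hB : ∀ t ∈ Icc 0 T, totVar P (u t) ≤ B) :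
    LocallyIntegrable (repSource P K a) := by
  obtain ⟨D, hD⟩ := ha.exists_ae_lintegral_le hP hK hB
  have hmeas : Measurable (repSource P K a) :=
    measurable_symmIntegral hK.measurable_halfKernel ha.measurable
  intro z
  refine ⟨univ ×ˢ Ioc (z.2 - P) (z.2 - P + 2 * P), ?_, hmeas.aestronglyMeasurable, ?_⟩
  · refine prod_mem_nhds univ_mem ?_
    exact mem_of_superset (Ioo_mem_nhds (by linarith) (by linarith)) Ioo_subset_Ioc_self
  · rw [HasFiniteIntegral, Measure.volume_eq_prod, ← Measure.prod_restrict, Measure.restrict_univ,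
      lintegral_prod _ hmeas.enorm.aemeasurable]
    have : ∫⁻ t, ∫⁻ x in Ioc (z.2 - P) (z.2 - P + 2 * P), ‖repSource P K a (t, x)‖ₑ ≤
        ∫⁻ t, (Ioo 0 T).indicator (fun _ => (D : ℝ≥0∞)) t := by
      refine lintegral_mono_ae ?_
      filter_upwards [hD] with t ht
      exact (lintegral_mono fun x => enorm_symmIntegral_le x).trans (ht _)
    refine this.trans_lt ?_
    rw [lintegral_indicator_const measurableSet_Ioo]
    exact ENNReal.mul_lt_top ENNReal.coe_lt_top (by simp)

lemma ae_Gper_eq (ha : IsPeriodicRep P T M u a) (hP : 0 < P)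
    (hK : KernelCondition P K) {B : ℝ≥0} (hB : ∀ t ∈ Icc 0 T, totVar P (u t) ≤ B) :
    ∀ᵐ z : ℝ × ℝ, z.1 ∈ Ioo 0 T → Gper P K (u z.1) z.2 = repSource P K a z := by
  have hmeas := measurable_symmLIntegral hK.measurable_halfKernel ha.measurable
  have h1 : ∀ᵐ z : ℝ × ℝ, symmLIntegral P K (fun x => a (z.1, x)) z.2 ≠ ∞ := by
    have hset : MeasurableSet {z : ℝ × ℝ | symmLIntegral P K (fun x => a (z.1, x)) z.2 ≠ ∞} :=
      hmeas (measurableSet_singleton ∞).compl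
    rw [Measure.volume_eq_prod, Measure.ae_prod_iff_ae_ae hset]
    exact ha.ae_symmLIntegral_ne_top hP hK hB
  have h2 : ∀ᵐ z : ℝ × ℝ, z.1 ∈ Ioo 0 T → ∀ᵐ x, u z.1 x = a (z.1, x) :=
    Measure.quasiMeasurePreserving_fst.ae ha.ae_ae_eq
  filter_upwards [h1, h2] with z hz1 hz2 hzT
  rw [repSource, ← hK.Gper_eq_symmIntegral hP (ha.measurable_slice z.1) (fun x => ha.bound _) hz1]
  simp only [Gper]
  congr 1
  ext ε
  refine setIntegral_congr_ae (measurableSet_Ioo.diff measurableSet_Ioo) ?_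
  have : ∀ᵐ y, u z.1 (z.2 - y) = a (z.1, z.2 - y) :=
    (quasiMeasurePreserving_sub_left volume z.2).ae (hz2 hzT)
  filter_upwards [this] with y hy _
  rw [hy]

/-- The representative satisfies the entropy inequalities on `(0, T) × ℝ`, with the absolutely
convergent singular integral as source. -/
lemma isKruzkovSolution (ha : IsPeriodicRep P T M u a) (hP : 0 < P)
    (hK : KernelCondition P K) {B : ℝ≥0} (hB : ∀ t ∈ Icc 0 T, totVar P (u t) ≤ B)
    (hu : IsEntropyWeakSolution P f K ubar u) :
    IsKruzkovSolution f a (repSource P K a) (Ioo 0 T ×ˢ univ) := by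
  intro k φ hφ hφc hφU hφ0
  have hsub : Ioo 0 T ×ˢ (univ : Set ℝ) ⊆ Ioi (0 : ℝ) ×ˢ (univ : Set ℝ) :=
    prod_mono Ioo_subset_Ioi_self subset_rfl
  obtain ⟨-, h⟩ := hu.entropy k φ hφ hφc (hφU.trans hsub) hφ0
  have hzero : ∀ z : ℝ × ℝ, z ∉ Ioo 0 T ×ˢ (univ : Set ℝ) →
      partialT φ z = 0 ∧ partialX φ z = 0 ∧ φ z = 0 := fun z hz =>
    have hz' : z ∉ tsupport φ := fun h => hz (hφU h)
    ⟨partialT_of_notMem_tsupport hφ hz', partialX_of_notMem_tsupport hφ hz',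
      image_eq_zero_of_notMem_tsupport hz'⟩
  have hE : ∀ z, entropyIntegrand P f K u k φ z = |u z.1 z.2 - k| * partialT φ z
      + (f (u z.1 z.2) - f k) * Real.sign (u z.1 z.2 - k) * partialX φ z
      + Gper P K (u z.1) z.2 * Real.sign (u z.1 z.2 - k) * φ z := fun z => rfl
  rw [setIntegral_eq_integral_of_forall_compl_eq_zero] at h
  · refine h.trans (le_of_eq (integral_congr_ae ?_))
    filter_upwards [ha.ae_eq, ha.ae_Gper_eq hP hK hB] with z h1 h2
    -- On `(0, T)` the two integrands agree; elsewhere the test function and its derivatives vanish.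
    by_cases hz : z.1 ∈ Ioo 0 T
    · rw [hE, h1 hz, h2 hz, kruzkovIntegrand]
    · obtain ⟨e1, e2, e3⟩ := hzero z fun h => hz h.1
      rw [hE, kruzkovIntegrand, e1, e2, e3]
      ring
  · intro z hz
    obtain ⟨e1, e2, e3⟩ := hzero z fun h => hz (hsub h)
    rw [hE, e1, e2, e3]
    ring

end IsPeriodicRep

end Representative

/-! ### Testing with periodic partitions of unity -/

section Testing

variable {P T M C : ℝ} {f K ubar : ℝ → ℝ} {u v : ℝ → ℝ → ℝ} {a b : ℝ × ℝ → ℝ}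

/-- Integration against a weight on two periods that is `g` on the first one and `c - g` on the
second one. -/
lemma integral_periodic_mul {h w g : ℝ → ℝ} {c : ℝ} (hP : 0 < P)
    (hper : Function.Periodic h (2 * P)) (hi : IntegrableOn h (Ioc (-P) P)) (hw : Continuous w)
    (hg : Continuous g) (h1 : ∀ x ∈ Ioo (-P) P, w x = g x)
    (h2 : ∀ x ∈ Ioo P (3 * P), w x = c - g (x - 2 * P)) (h0 : ∀ x ∉ Icc (-P) (3 * P), w x = 0) :
    Integrable (fun x => h x * w x) ∧ ∫ x, h x * w x = c * ∫ x in Ioc (-P) P, h x := by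
  have hii : IntervalIntegrable h volume (-P) (-P + 2 * P) := by
    rw [intervalIntegrable_iff_integrableOn_Ioc_of_le (by linarith), show -P + 2 * P = P by ring]
    exact hi
  have hall := hper.intervalIntegrable (by linarith) hii
  have hz : ∀ x ∉ Icc (-P) (3 * P), h x * w x = 0 := fun x hx => by rw [h0 x hx, mul_zero]
  have hint : ∀ p q, IntervalIntegrable (fun x => h x * w x) volume p q := fun p q =>
    (hall p q).mul_continuousOn hw.continuousOn
  refine ⟨?_, ?_⟩
  · have := (hint (-P) (3 * P))
    rw [intervalIntegrable_iff_integrableOn_Icc_of_le (by linarith)] at this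
    exact this.integrable_of_forall_notMem_eq_zero hz
  · rw [← setIntegral_eq_integral_of_forall_compl_eq_zero hz, integral_Icc_eq_integral_Ioc,
      ← intervalIntegral.integral_of_le (by linarith),
      ← intervalIntegral.integral_add_adjacent_intervals (hint (-P) P) (hint P (3 * P))]
    have e1 : ∫ x in (-P)..P, h x * w x = ∫ x in (-P)..P, h x * g x := by
      refine intervalIntegral.integral_congr_uIoo fun x hx => ?_
      rw [uIoo_of_le (by linarith)] at hx
      simp only [h1 x hx]
    have e2 : ∫ x in P..(3 * P), h x * w x = ∫ x in (-P)..P, h x * (c - g x) := by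
      have : ∫ x in P..(3 * P), h x * w x =
          ∫ x in P..(3 * P), h (x - 2 * P) * (c - g (x - 2 * P)) := by
        refine intervalIntegral.integral_congr_uIoo fun x hx => ?_
        rw [uIoo_of_le (by linarith)] at hx
        simp only [h2 x hx, hper.sub_eq x]
      rw [this, intervalIntegral.integral_comp_sub_right (fun x => h x * (c - g x))]
      congr 1 <;> ring
    have i1 : IntervalIntegrable (fun x => h x * g x) volume (-P) P :=
      (hall _ _).mul_continuousOn hg.continuousOn
    have i2 : IntervalIntegrable (fun x => h x * (c - g x)) volume (-P) P :=
      (hall _ _).mul_continuousOn (continuous_const.sub hg).continuousOn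
    rw [e1, e2, ← intervalIntegral.integral_add i1 i2, ← intervalIntegral.integral_of_le
      (by linarith), ← intervalIntegral.integral_const_mul]
    exact intervalIntegral.integral_congr fun x _ => by ring

/-- The translates of `periodCutoff P` by multiples of `2P` form a partition of unity. -/
noncomputable def periodCutoff (P : ℝ) : ℝ → ℝ := plateau (-P) P (2 * P)

/-- The falling edge of `periodCutoff P` is the translate of the rising edge by one period. -/
lemma smoothStep_right_eq (x : ℝ) :
    smoothStep P (2 * P) x = smoothStep (-P) (2 * P) (x - 2 * P) := by
  rw [← smoothStep_sub]
  congr 1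
  ring

lemma integral_periodic_mul_periodCutoff {h : ℝ → ℝ} (hP : 0 < P)
    (hper : Function.Periodic h (2 * P)) (hi : IntegrableOn h (Ioc (-P) P)) :
    Integrable (fun x => h x * periodCutoff P x) ∧
      ∫ x, h x * periodCutoff P x = ∫ x in Ioc (-P) P, h x := by
  have h2P : 0 < 2 * P := by linarith
  have := integral_periodic_mul (c := 1) (w := periodCutoff P) (g := smoothStep (-P) (2 * P)) hP
    hper hi contDiff_plateau.continuous contDiff_smoothStep.continuous
    (fun x hx => by rw [periodCutoff, plateau, smoothStep_of_le h2P hx.2.le, sub_zero])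
    (fun x hx => by
      rw [periodCutoff, plateau, smoothStep_of_ge h2P (by linarith [hx.1]), smoothStep_right_eq])
    (fun x hx => plateau_of_notMem h2P (by linarith) (by
      rwa [show P + 2 * P = 3 * P by ring]))
  rwa [one_mul] at this

lemma integral_periodic_mul_deriv_periodCutoff {h : ℝ → ℝ} (hP : 0 < P)
    (hper : Function.Periodic h (2 * P)) (hi : IntegrableOn h (Ioc (-P) P)) :
    Integrable (fun x => h x * deriv (periodCutoff P) x) ∧
      ∫ x, h x * deriv (periodCutoff P) x = 0 := by
  have h2P : 0 < 2 * P := by linarith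
  have hd : ∀ x, deriv (smoothStep P (2 * P)) x = deriv (smoothStep (-P) (2 * P)) (x - 2 * P) :=
    fun x => by
      rw [← deriv_comp_sub_const]
      congr 1
      exact funext smoothStep_right_eq
  have hl : ∀ x, x ∉ Icc (-P) P → deriv (smoothStep (-P) (2 * P)) x = 0 := fun x hx =>
    deriv_smoothStep_of_notMem h2P (by rwa [show -P + 2 * P = P by ring])
  have hr : ∀ x, x ∉ Icc P (3 * P) → deriv (smoothStep P (2 * P)) x = 0 := fun x hx =>
    deriv_smoothStep_of_notMem h2P (by rwa [show P + 2 * P = 3 * P by ring])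
  have := integral_periodic_mul (c := 0) (w := deriv (periodCutoff P))
    (g := deriv (smoothStep (-P) (2 * P))) hP hper
    hi (contDiff_plateau.continuous_deriv le_rfl) continuous_deriv_smoothStep
    (fun x hx => by
      rw [periodCutoff, deriv_plateau, hr x fun h => by linarith [h.1, hx.2], sub_zero])
    (fun x hx => by
      rw [periodCutoff, deriv_plateau, hl x fun h => by linarith [h.2, hx.1], hd])
    (fun x hx => by
      rw [periodCutoff, deriv_plateau, hl x fun h => hx ⟨h.1, by linarith [h.2]⟩,
        hr x fun h => hx ⟨by linarith [h.1], h.2⟩, sub_zero])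
  rwa [zero_mul] at this

/-- The Kato inequality, tested with `θ t * periodCutoff P x`: the flux term drops out. -/
lemma integral_time_inequality {B : ℝ≥0} (hP : 0 < P) (hf : ContDiff ℝ 1 f)
    (hK : KernelCondition P K) (ha : IsPeriodicRep P T M u a) (hb : IsPeriodicRep P T M v b)
    (hu : IsEntropyWeakSolution P f K ubar u) (hv : IsEntropyWeakSolution P f K ubar v)
    (hBu : ∀ t ∈ Icc 0 T, totVar P (u t) ≤ B) (hBv : ∀ t ∈ Icc 0 T, totVar P (v t) ≤ B)
    {θ R : ℝ → ℝ} (hθ : ContDiff ℝ 1 θ) (hθc : HasCompactSupport θ) (hθT : tsupport θ ⊆ Ioo 0 T)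
    (hθ0 : ∀ t, 0 ≤ θ t)
    (hR : ∀ᵐ t, t ∈ Ioo 0 T →
      ∫ x in Ioc (-P) P, |repSource P K a (t, x) - repSource P K b (t, x)| ≤ R t)
    (hint : Integrable fun t =>
      deriv θ t * (∫ x in Ioc (-P) P, |a (t, x) - b (t, x)|) + θ t * R t) :
    0 ≤ ∫ t, (deriv θ t * (∫ x in Ioc (-P) P, |a (t, x) - b (t, x)|) + θ t * R t) := by
  obtain ⟨Λ, hΛ⟩ := hf.contDiffOn.exists_lipschitzOnWith one_ne_zero (convex_Icc (-M) M)
    isCompact_Icc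
  have hD : DoublingData f a b (repSource P K a) (repSource P K b) M Λ :=
    ⟨hf.continuous, hΛ, ha.measurable, hb.measurable, ha.bound, hb.bound,
      ha.locallyIntegrable_repSource hP hK hBu, hb.locallyIntegrable_repSource hP hK hBv⟩
  set χ := periodCutoff P with hχ
  have h2P : 0 < 2 * P := by linarith
  have hχ1 : ContDiff ℝ 1 χ := contDiff_plateau
  have hχc : HasCompactSupport χ := hasCompactSupport_plateau h2P (by linarith)
  set Ψ : ℝ × ℝ → ℝ := fun z => θ z.1 * χ z.2 with hΨ
  have hΨ1 : ContDiff ℝ 1 Ψ := (hθ.comp contDiff_fst).mul (hχ1.comp contDiff_snd)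
  have hsupp : tsupport Ψ ⊆ tsupport θ ×ˢ tsupport χ :=
    closure_minimal (fun z hz => ⟨subset_tsupport _ (left_ne_zero_of_mul hz),
      subset_tsupport _ (right_ne_zero_of_mul hz)⟩)
      ((isClosed_tsupport θ).prod (isClosed_tsupport χ))
  have hΨc : HasCompactSupport Ψ :=
    (hθc.isCompact.prod hχc.isCompact).of_isClosed_subset (isClosed_tsupport _) hsupp
  have hkato := hD.kato (isOpen_Ioo.prod isOpen_univ) (ha.isKruzkovSolution hP hK hBu hu)
    (hb.isKruzkovSolution hP hK hBv hv) hΨ1 hΨc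
    (fun z => mul_nonneg (hθ0 _) (plateau_nonneg h2P (by linarith) _))
    (hsupp.trans (prod_mono hθT (subset_univ _)))
  have iK := hD.integrable_kato_translate hΨ1 hΨc 0
  simp only [add_zero] at iK
  rw [Measure.volume_eq_prod] at iK hkato
  rw [integral_prod _ iK] at hkato
  refine hkato.trans (integral_mono_ae iK.integral_prod_left hint ?_)
  obtain ⟨Da, hDa⟩ := ha.exists_ae_lintegral_le hP hK hBu
  obtain ⟨Db, hDb⟩ := hb.exists_ae_lintegral_le hP hK hBv
  have slice : ∀ {c : ℝ × ℝ → ℝ} {w : ℝ → ℝ → ℝ} {D : ℝ≥0} {t : ℝ}, IsPeriodicRep P T M w c →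
      (∀ e : ℝ, ∫⁻ x in Ioc e (e + 2 * P), symmLIntegral P K (fun x => c (t, x)) x ≤
        (Ioo 0 T).indicator (fun _ => (D : ℝ≥0∞)) t) →
      IntegrableOn (fun x => repSource P K c (t, x)) (Ioc (-P) P) := by
    intro c w D t hc h
    refine ⟨((measurable_symmIntegral hK.measurable_halfKernel hc.measurable).comp
      measurable_prodMk_left).aestronglyMeasurable, ?_⟩
    have h' := h (-P)
    rw [show -P + 2 * P = P by ring] at h'
    refine ((lintegral_mono fun x => enorm_symmIntegral_le x).trans h').trans_lt ?_
    by_cases ht : t ∈ Ioo 0 T <;> simp [ht]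
  filter_upwards [hR, hDa, hDb] with t htR hta htb
  have pa := ha.periodic t
  have pb := hb.periodic t
  have e1 := integral_periodic_mul_periodCutoff (h := fun x => |a (t, x) - b (t, x)|) hP
    (fun x => by simp only [pa x, pb x])
    ((ha.integrableOn_slice t).sub (hb.integrableOn_slice t)).norm
  have e2 := integral_periodic_mul_deriv_periodCutoff
    (h := fun x => f (max (a (t, x)) (b (t, x))) - f (min (a (t, x)) (b (t, x)))) hP
    (fun x => by simp only [pa x, pb x])
    (Measure.integrableOn_of_bounded (M := Λ * (M + M)) (by simp)
      (hD.measurable_flux.comp ((measurable_prodMk_left (x := t)).prodMk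
        (measurable_prodMk_left (x := t)))).aestronglyMeasurable
      (ae_of_all _ fun x => abs_flux_sub_le hΛ (ha.bound _) (hb.bound _)))
  have e3 := integral_periodic_mul_periodCutoff
    (h := fun x => |repSource P K a (t, x) - repSource P K b (t, x)|) hP
    (fun x => by
      have qa := periodic_symmIntegral (K := K) pa x
      have qb := periodic_symmIntegral (K := K) pb x
      simp only [repSource, qa, qb])
    ((slice ha hta).sub (slice hb htb)).norm
  have hpt : ∀ z, partialT Ψ z = deriv θ z.1 * χ z.2 := fun z =>
    deriv_mul_const_field (u := θ) (v := χ z.2)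
  have hpx : ∀ z, partialX Ψ z = θ z.1 * deriv χ z.2 := fun z => deriv_const_mul_field (θ z.1)
  have hin : ∫ x, katoIntegrand f a b (repSource P K a) (repSource P K b) Ψ (t, x) (t, x) =
      deriv θ t * (∫ x in Ioc (-P) P, |a (t, x) - b (t, x)|) +
      θ t * ∫ x in Ioc (-P) P, |repSource P K a (t, x) - repSource P K b (t, x)| := by
    have i1 := e1.1.const_mul (deriv θ t)
    have i2 := e2.1.const_mul (θ t)
    have i3 := e3.1.const_mul (θ t)
    rw [← e1.2, ← e3.2, ← add_zero (deriv θ t * _), ← mul_zero (θ t), ← e2.2,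
      ← integral_const_mul, ← integral_const_mul, ← integral_const_mul, ← integral_add i1 i2,
      ← integral_add (by exact i1.add i2) i3]
    congr 1
    ext x
    simp only [katoIntegrand, hpt, hpx]
    ring
  rw [hin]
  by_cases ht : t ∈ Ioo 0 T
  · linarith [mul_le_mul_of_nonneg_left (htR ht) (hθ0 t)]
  · have : θ t = 0 := image_eq_zero_of_notMem_tsupport fun h => ht (hθT h)
    simp [this]

end Testing

/-! ### Osgood's argument -/

section Osgood

/-- If for every `l > 0` the function `m + κ`, with `κ = E e ^ (-l) / l`, grows at most at the
exponential rate `2 C l`, then `m` stays zero: over a time `1 / (2 C)` the growth factor is at most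
`e ^ l`, so that `m ≤ E / l`. -/
lemma eq_zero_of_antitoneOn_exp_mul {T C E : ℝ} {m : ℝ → ℝ} (hC : 0 < C) (hE : 0 ≤ E)
    (hm : ∀ t ∈ Icc 0 T, 0 ≤ m t) (hm0 : m 0 = 0)
    (h : ∀ l : ℝ, 0 < l → AntitoneOn
      (fun t => Real.exp (-(2 * C * l * t)) * (m t + E * Real.exp (-l) / l)) (Icc 0 T)) :
    ∀ t ∈ Icc 0 T, m t = 0 := by
  have step : ∀ s ∈ Icc 0 T, ∀ t ∈ Icc 0 T, s ≤ t → 2 * C * (t - s) ≤ 1 → m s = 0 → m t = 0 := by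
    intro s hs t ht hst hd hms
    refine le_antisymm ?_ (hm t ht)
    have hle : ∀ l : ℝ, 0 < l → m t ≤ E / l := by
      intro l hl
      have h1 := h l hl hs ht hst
      simp only [hms, zero_add] at h1
      have h2 : m t + E * Real.exp (-l) / l ≤
          Real.exp (2 * C * l * (t - s)) * (E * Real.exp (-l) / l) := by
        have h3 := mul_le_mul_of_nonneg_left h1 (Real.exp_pos (2 * C * l * t)).le
        rw [← mul_assoc, ← mul_assoc, ← Real.exp_add, ← Real.exp_add, add_neg_cancel,
          Real.exp_zero, one_mul] at h3
        rwa [show 2 * C * l * t + -(2 * C * l * s) = 2 * C * l * (t - s) by ring] at h3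
      have h4 : Real.exp (2 * C * l * (t - s)) ≤ Real.exp l := by
        refine Real.exp_le_exp.2 ?_
        have := mul_le_mul_of_nonneg_right hd hl.le
        linarith
      have h5 : Real.exp l * (E * Real.exp (-l) / l) = E / l := by
        rw [show Real.exp l * (E * Real.exp (-l) / l) =
            Real.exp l * Real.exp (-l) * (E / l) by ring,
          ← Real.exp_add, add_neg_cancel, Real.exp_zero, one_mul]
      have h6 : 0 ≤ E * Real.exp (-l) / l := by positivity
      have h7 := mul_le_mul_of_nonneg_right h4 h6
      linarith
    have hlim : Tendsto (fun l : ℝ => E / l) atTop (𝓝 0) := tendsto_const_nhds.div_atTop tendsto_id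
    exact ge_of_tendsto hlim ((eventually_gt_atTop 0).mono hle)
  -- The length of a step does not depend on its starting point, so `[0, T]` is exhausted.
  have hall : ∀ n : ℕ, ∀ t ∈ Icc 0 T, 2 * C * t ≤ n → m t = 0 := by
    intro n
    induction n with
    | zero =>
      intro t ht htn
      have h1 : 2 * C * t ≤ 0 := by exact_mod_cast htn
      have : t ≤ 0 := nonpos_of_mul_nonpos_right h1 (by linarith)
      rw [le_antisymm this ht.1, hm0]
    | succ n ih =>
      intro t ht htn
      push_cast at htn
      have hC2 : 0 < 2 * C := by linarith
      have hcancel : 2 * C * (1 / (2 * C)) = 1 := by field_simp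
      have hpos : 0 < 1 / (2 * C) := by positivity
      have hs : max 0 (t - 1 / (2 * C)) ∈ Icc 0 T :=
        ⟨le_max_left _ _, max_le (ht.1.trans ht.2) (by linarith [ht.2])⟩
      refine step _ hs t ht (max_le ht.1 (by linarith)) ?_ (ih _ hs ?_)
      · have := mul_le_mul_of_nonneg_left (le_max_right 0 (t - 1 / (2 * C))) hC2.le
        rw [mul_sub, hcancel] at this
        rw [mul_sub]
        linarith
      · rcases max_choice 0 (t - 1 / (2 * C)) with h0 | h0
        · rw [h0, mul_zero]; positivity
        · rw [h0, mul_sub, hcancel]; linarith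
  intro t ht
  obtain ⟨n, hn⟩ := exists_nat_ge (2 * C * t)
  exact hall n t ht hn

end Osgood

/-! ### Uniqueness -/

section Uniqueness

variable {P T M C : ℝ} {f K ubar : ℝ → ℝ} {u v : ℝ → ℝ → ℝ} {a b : ℝ × ℝ → ℝ}

/-- The logarithmic bound for the `L¹` distance of the sources in terms of the `L¹` distance of the
solutions, with a free cut-off radius `δ`. -/
lemma ae_integral_abs_repSource_sub_le {B : ℝ≥0} (hP : 0 < P)
    (hK : KernelCondition P K) (hC0 : 0 ≤ C) (hC : ∀ y ∈ Ioc 0 P, |K y| ≤ C / y)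
    (ha : IsPeriodicRep P T M u a) (hb : IsPeriodicRep P T M v b)
    (hBu : ∀ t ∈ Icc 0 T, totVar P (u t) ≤ B) (hBv : ∀ t ∈ Icc 0 T, totVar P (v t) ≤ B)
    {δ : ℝ} (hδ : 0 < δ) (hδP : δ ≤ P) :
    ∀ᵐ t, t ∈ Ioo 0 T →
      ∫ x in Ioc (-P) P, |repSource P K a (t, x) - repSource P K b (t, x)| ≤
        2 * C * (4 * (B + 1)) * δ +
          2 * C * (∫ x in Ioc (-P) P, |a (t, x) - b (t, x)|) * Real.log (P / δ) := by
  have hk := hK.measurable_halfKernel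
  filter_upwards [ha.ae_translationBound hBu, hb.ae_translationBound hBv,
    ha.ae_symmLIntegral_ne_top hP hK hBu, hb.ae_symmLIntegral_ne_top hP hK hBv]
    with t hta htb hfa hfb htT
  have hma := ha.measurable_slice t
  have hmb := hb.measurable_slice t
  have hwβ := (hta htT).sub (htb htT) (by positivity) (by positivity) hma
  rw [show (2 * (B + 1) + 2 * (B + 1) : ℝ) = 4 * (B + 1) by ring] at hwβ
  have hi := (ha.integrableOn_slice t).sub (hb.integrableOn_slice t)
  have key := lintegral_symmLIntegral_le (m := ∫ x in Ioc (-P) P, |a (t, x) - b (t, x)|) hk hC0 hC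
    (hma.sub hmb) ((ha.periodic t).sub (hb.periodic t)) (by positivity) hwβ hδ hδP
    (integral_nonneg fun _ => abs_nonneg _) (ofReal_integral_norm_eq_lintegral_enorm hi).ge
  have hnn : 0 ≤ 2 * C * (4 * (B + 1)) * δ +
      2 * C * (∫ x in Ioc (-P) P, |a (t, x) - b (t, x)|) * Real.log (P / δ) := by
    have h1 : 0 ≤ Real.log (P / δ) := Real.log_nonneg ((one_le_div hδ).2 hδP)
    have h2 : 0 ≤ ∫ x in Ioc (-P) P, |a (t, x) - b (t, x)| := integral_nonneg fun _ => abs_nonneg _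
    positivity
  have hmeas : Measurable fun x => repSource P K a (t, x) - repSource P K b (t, x) :=
    ((measurable_symmIntegral hk ha.measurable).comp measurable_prodMk_left).sub
      ((measurable_symmIntegral hk hb.measurable).comp measurable_prodMk_left)
  have hle : ∫⁻ x in Ioc (-P) P, ‖repSource P K a (t, x) - repSource P K b (t, x)‖ₑ ≤
      ∫⁻ x in Ioc (-P) P, symmLIntegral P K (fun x => a (t, x) - b (t, x)) x := by
    refine lintegral_mono_ae (ae_restrict_of_ae ?_)
    filter_upwards [hfa, hfb] with x hxa hxb
    simp only [repSource]
    rw [symmIntegral_sub hk hma hmb hxa hxb]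
    exact enorm_symmIntegral_le x
  simp only [← Real.norm_eq_abs (repSource P K a _ - _)]
  rw [integral_norm_eq_lintegral_enorm hmeas.aestronglyMeasurable]
  exact ENNReal.toReal_le_of_le_ofReal hnn (hle.trans key)

lemma IsEntropyWeakSolution.aestronglyMeasurable (hu : IsEntropyWeakSolution P f K ubar u) (T : ℝ) :
    AEStronglyMeasurable (fun z : ℝ × ℝ => u z.1 z.2)
      (volume.restrict (Ioo 0 T ×ˢ (univ : Set ℝ))) :=
  hu.locallyIntegrable.aestronglyMeasurable.mono_measure
    (Measure.restrict_mono (prod_mono (Ioo_subset_Ioi_self.trans Ioi_subset_Ici_self) subset_rfl)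
      le_rfl)

lemma integral_abs_sub_eq_zero_of_totVar_le {B : ℝ≥0} (hP : 0 < P) (hf : ContDiff ℝ 1 f)
    (hK : KernelCondition P K)
    (hu : IsEntropyWeakSolution P f K ubar u) (hv : IsEntropyWeakSolution P f K ubar v)
    (hBu : ∀ t ∈ Icc 0 T, totVar P (u t) ≤ B) (hBv : ∀ t ∈ Icc 0 T, totVar P (v t) ≤ B) :
    ∀ t ∈ Icc 0 T, ∫ x in Icc (-P) P, |u t x - v t x| = 0 := by
  obtain ⟨Mu, hMu⟩ := hu.exists_forall_ae_abs_le hP hBu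
  obtain ⟨Mv, hMv⟩ := hv.exists_forall_ae_abs_le hP hBv
  set M := max 0 (max Mu Mv)
  obtain ⟨a, ha⟩ := exists_isPeriodicRep (M := M) hP (hu.aestronglyMeasurable T)
    (fun t ht => (hu.mem_L2per t ht.1.le).periodic) (le_max_left _ _) fun t ht =>
      (hMu t (Ioo_subset_Icc_self ht)).mono fun x hx =>
        hx.trans ((le_max_left _ _).trans (le_max_right _ _))
  obtain ⟨b, hb⟩ := exists_isPeriodicRep (M := M) hP (hv.aestronglyMeasurable T)
    (fun t ht => (hv.mem_L2per t ht.1.le).periodic) (le_max_left _ _) fun t ht =>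
      (hMv t (Ioo_subset_Icc_self ht)).mono fun x hx =>
        hx.trans ((le_max_right _ _).trans (le_max_right _ _))
  obtain ⟨C, hC0, hC⟩ := hK.bound
  have hC' : ∀ y ∈ Ioc 0 P, |K y| ≤ C / y := fun y hy => by
    have := (hC y ⟨by linarith [hy.1], hy.2⟩ hy.1.ne').1
    rwa [abs_of_pos hy.1] at this
  set m : ℝ → ℝ := fun t => ∫ x in Icc (-P) P, |u t x - v t x| with hm
  have hmc : ContinuousOn m (Icc 0 T) :=
    (continuousOn_integral_abs_sub (fun t ht => (hu.mem_L2per t ht).memLp) hu.continuous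
      (fun t ht => (hv.mem_L2per t ht).memLp) hv.continuous).mono Icc_subset_Ici_self
  have hmab : ∀ᵐ t, t ∈ Ioo 0 T → ∫ x in Ioc (-P) P, |a (t, x) - b (t, x)| = m t := by
    filter_upwards [ha.ae_ae_eq, hb.ae_ae_eq] with t hta htb htT
    simp only [hm]
    rw [integral_Icc_eq_integral_Ioc]
    refine integral_congr_ae (ae_restrict_of_ae ?_)
    filter_upwards [hta htT, htb htT] with x h1 h2
    rw [h1, h2]
  refine eq_zero_of_antitoneOn_exp_mul (m := m) (E := 4 * (B + 1) * P) hC0 (by positivity)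
    (fun t _ => integral_nonneg fun _ => abs_nonneg _) ?_ fun l hl => ?_
  · refine integral_eq_zero_of_ae (ae_restrict_of_ae ?_)
    filter_upwards [hu.initial, hv.initial] with x h1 h2
    simp [h1, h2]
  set κ := 4 * (B + 1) * P * Real.exp (-l) / l with hκ
  refine antitoneOn_exp_mul_of_distributional_le (L := 2 * C * l) hmc fun θ hθ hθc hθT hθ0 => ?_
  -- The cut-off radius of the singular integral is `P e ^ (-l)`, so that the logarithm equals `l`.
  have hδP : P * Real.exp (-l) ≤ P :=
    mul_le_of_le_one_right hP.le (Real.exp_le_one_iff.2 (by linarith))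
  have hlog : Real.log (P / (P * Real.exp (-l))) = l := by
    rw [← div_div, div_self hP.ne', Real.exp_neg, one_div, inv_inv, Real.log_exp]
  have hR : ∀ᵐ t, t ∈ Ioo 0 T →
      ∫ x in Ioc (-P) P, |repSource P K a (t, x) - repSource P K b (t, x)| ≤
        2 * C * l * (m t + κ) := by
    filter_upwards [hmab, ae_integral_abs_repSource_sub_le hP hK hC0.le hC' ha hb hBu hBv
      (mul_pos hP (Real.exp_pos (-l))) hδP] with t h1 h2 ht
    have := h2 ht
    rw [h1 ht, hlog] at this
    refine this.trans (le_of_eq ?_)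
    rw [hκ]
    field_simp
    ring
  have heq : (fun t => deriv θ t * m t + θ t * (2 * C * l * (m t + κ))) =ᵐ[volume]
      fun t => deriv θ t * (∫ x in Ioc (-P) P, |a (t, x) - b (t, x)|)
        + θ t * (2 * C * l * (m t + κ)) := by
    filter_upwards [hmab] with t ht
    by_cases htT : t ∈ Ioo 0 T
    · rw [ht htT]
    · have : deriv θ t = 0 := image_eq_zero_of_notMem_tsupport fun h =>
        htT (hθT (tsupport_deriv_subset h))
      simp [this]
  have hint : Integrable fun t => deriv θ t * m t + θ t * (2 * C * l * (m t + κ)) :=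
    (integrable_mul_of_tsupport_subset_Ioo (hθ.continuous_deriv le_rfl)
      (tsupport_deriv_subset.trans hθT) hmc).add
    (integrable_mul_of_tsupport_subset_Ioo hθ.continuous hθT
      (continuousOn_const.mul (hmc.add continuousOn_const)))
  rw [integral_congr_ae heq]
  exact integral_time_inequality hP hf hK ha hb hu hv hBu hBv hθ hθc hθT hθ0 hR (hint.congr heq)

end Uniqueness

end PerBalance

theorem mainTheorem3 (P : ℝ) (hP : 0 < P) (f K : ℝ → ℝ)
    (hF : PerBalance.FluxCondition f) (hK : PerBalance.KernelCondition P K)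
    (ubar : ℝ → ℝ) (hubar : PerBalance.L2per P ubar) (u v : ℝ → ℝ → ℝ)
    (hu : PerBalance.IsEntropyWeakSolution P f K ubar u)
    (hv : PerBalance.IsEntropyWeakSolution P f K ubar v)
    (T : ℝ)
    (hTV : ∃ B : ℝ≥0, ∀ t ∈ Set.Icc 0 T,
      PerBalance.totVar P (u t) ≤ B ∧ PerBalance.totVar P (v t) ≤ B) :
    ∀ t ∈ Set.Icc 0 T, u t =ᵐ[MeasureTheory.volume] v t := by
  obtain ⟨B, hB⟩ := hTV
  intro t ht
  have hut := hu.mem_L2per t ht.1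
  have hvt := hv.mem_L2per t ht.1
  have h0 := PerBalance.integral_abs_sub_eq_zero_of_totVar_le hP hF.contDiff hK hu hv
    (fun t ht => (hB t ht).1) (fun t ht => (hB t ht).2) t ht
  have hi : Integrable (fun x => |u t x - v t x|) (volume.restrict (Icc (-P) P)) :=
    ((hut.memLp.sub hvt.memLp).integrable (by norm_num)).norm
  rw [integral_eq_zero_iff_of_nonneg (fun _ => abs_nonneg _) hi] at h0
  have h1 : ∀ᵐ x, x ∈ Icc (-P) P → u t x = v t x := by
    filter_upwards [(ae_restrict_iff' measurableSet_Icc).1 h0] with x hx hxm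
    exact sub_eq_zero.1 (abs_eq_zero.1 (hx hxm))
  filter_upwards [PerBalance.ae_periodPoint_of_ae_Icc hP h1,
    PerBalance.ae_periodPoint hP hut.periodic, PerBalance.ae_periodPoint hP hvt.periodic]
    with x h2 h3 h4
  rw [← h3, ← h4, h2]
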